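/- A \emph{cs} manifold is a space with a sheaf of complex supercommutative algebras that is locally isomorphic to $\mathbb A^{m|n}=(\mathbb R^m,\mathcal C^\infty(\cdot,\mathbb C)\otimes\bigwedge(\mathbb C^n)^*)$. Let $S$ be a \emph{cs} manifold, $p,q\ge 0$ integers, and let $(v,\xi)=(v_1,\dots,v_p,\xi_1,\dots,\xi_{2q})$ be the standard coordinates on $\mathbb A^{p|2q}$, with $\|x\|^2=\sum_i v_i^2+2\sum_{j=1}^q\xi_{2j-1}\xi_{2j}$ and $|D\lambda|=(-2\pi)^{-q}|D(v,\xi)|$. For $f=\sum_I\xi^If_I\in\Gamma(\mathcal O_{S\times\mathbb A^{p|2q}})$ the Berezin fibre integral is $\int |D\lambda(x)|\,f(s,x)=(-2\pi)^{-q}\int_{\mathbb R^p}f_{\{1,\dots,2q\}}(s,v)\,dv$, computed coefficientwise in local coordinates $(s,\theta)$ of $S$; it exists if all these integrals converge absolutely. Let $f$ be rotationally invariant over $S$ with radial profile $f^\circ$. That is: if $p>0$, then $f^\circ$ is a superfunction on $S\times(-\varepsilon,\infty)$ for some $\varepsilon>0$, and $f(s,x)=f^\circ(s,\|x\|)$ over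 $\mathbb R^p\setminus\{0\}$; if $p=0$, then $f(s,x)=g(s,\|x\|^2)$ for a superfunction $g$ on $S\times\mathbb A^1$, and $f^\circ(s,t)=g(s,t^2)$. Below, derivatives at $r=0$ of $r\mapsto f^\circ(s,\sqrt r)$ are one-sided. (1) If $p>0$, then for every local coordinate system $(s,\theta)$ of $S$, every point $s$, and every coefficient with respect to $\theta$, $$\int |D\lambda(x)|\,f(s,x)=\frac{\pi^{\frac{p-2q}2}(-1)^q}{\Gamma(\frac p2)}\int_0^\infty r^{\frac p2-1}\,\partial_r^q f^\circ(s,\sqrt r)\,dr,$$ where the left-hand side converges absolutely if and only if the right-hand side does. If $p=0$, the integral exists and equals $(-\pi)^{-q}\,\partial^q_{r=0}f^\circ(s,\sqrt r)$. Assume from now on that $f$ is compactly supported in the fibres, i.e. that $\operatorname{supp} f\to S_0$ is proper. Then the fibre integral of $f$ exists and is a superfunction on $S$, and the following hold. (2) For every integer $0\le k\le\min(\frac p2,q)$ there is a superfunction on $S\times\mathbb A^{p-2k|2q-2k}$ given by $(s,x)\mapsto f^\circ(s,\|x\|)$, namely the Taylor expansion $\sum_l\frac1{l!}\,\partial_r^l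 f^\circ(s,\sqrt r)\big|_{r=\|v\|^2}\,\|\xi\|^{2l}$ where $\|x\|^2=\|v\|^2+\|\xi\|^2$; it is compactly supported in the fibres, and its fibre integral equals that of $f$. More generally, if $p'-2q'=p-2q$ and $f'$ on $S\times\mathbb A^{p'|2q'}$ is given in this way by $f^\circ(s,\|x\|)$ and is compactly supported in the fibres, then $f$ and $f'$ have the same fibre integral, so that the integral depends only on $p-2q$ and $f^\circ$. (3) The fibre integral $\int|D\lambda(x)|\,f(s,x)$ equals, with absolutely convergent integrals over $r$: - if $p-2q>0$: $\displaystyle\frac{2\pi^{\frac{p-2q}2}}{\Gamma(\frac{p-2q}2)}\int_0^\infty r^{p-2q-1}f^\circ(s,r)\,dr$; - if $p-2q\le0$ is even: $\displaystyle(-\pi)^{\frac{p-2q}2}\,\partial_{r=0}^{\frac{2q-p}2}f^\circ(s,\sqrt r)=(-\pi)^{\frac{p-2q}2}\,\frac{(\frac{2q-p}2)!}{(2q-p)!}\,\partial_{r=0}^{2q-p}f^\circ(s,r)$; - if $p-2q<0$ is odd: $\displaystyle(-\pi)^{\frac{p-1-2q}2}\int_0^\infty r^{-\frac12}\,\partial_r^{\frac{2q+1-p}2}f^\circ(s,\sqrt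 r)\,dr$. -/

import Mathlib

open Set MeasureTheory
open scoped ContDiff Nat

universe u v w

noncomputable section

/-! ### Grassmann algebras -/

/-- The Grassmann algebra `⋀ (ℂⁿ)^*` on `n` odd generators. -/
abbrev Grass (n : ℕ) : Type := ExteriorAlgebra ℂ (Fin n → ℂ)

namespace Grass

/-- The odd generators `θ_j`. -/
def gen {n : ℕ} (j : Fin n) : Grass n := ExteriorAlgebra.ι ℂ (Pi.single j 1)

/-- The basis `θ^J`, the product of the `θ_j`, `j ∈ J`, in increasing order. -/
def basis (n : ℕ) : Module.Basis (Finset (Fin n)) ℂ (Grass n) :=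
  (Pi.basisFun ℂ (Fin n)).ExteriorAlgebra

/-- The coefficient `a_J` in `a = ∑_J a_J θ^J`; the body (value) of `a` is `coef ∅ a`. -/
def coef {n : ℕ} (J : Finset (Fin n)) (a : Grass n) : ℂ := (basis n).repr a J

/-- The nilpotent part `a - a_∅`. -/
def nil {n : ℕ} (a : Grass n) : Grass n := a - algebraMap ℂ (Grass n) (coef ∅ a)

def IsEven {n : ℕ} (a : Grass n) : Prop := ∀ J : Finset (Fin n), Odd J.card → coef J a = 0

def IsOdd {n : ℕ} (a : Grass n) : Prop := ∀ J : Finset (Fin n), Even J.card → coef J a = 0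

/-- The value at a point of the pullback of the superfunction `F = ∑_J F_J θ'^J` on (an open
subspace of) `𝔸^{m'|n'}` along the morphism whose components at that point are `u` (pullbacks of the
even coordinates, with real body) and `w` (pullbacks of the odd coordinates):
`∑_J (∑_k 1/k! ∑_a ∂_{a_1} ⋯ ∂_{a_k} F_J (body u) · nil (u_{a_1}) ⋯ nil (u_{a_k})) w^J`.
Products of more than `n` nilpotent even elements of `Grass n` vanish. -/
def pull {n m' n' : ℕ} (u : Fin m' → Grass n) (w : Fin n' → Grass n)
    (F : (Fin m' → ℝ) → Grass n') : Grass n :=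
  ∑ J : Finset (Fin n'),
    (∑ k ∈ Finset.range (n + 1), ((k ! : ℂ)⁻¹) • ∑ a : Fin k → Fin m',
      (iteratedFDeriv ℝ k (fun y => coef J (F y)) (fun c => (coef ∅ (u c)).re)
        (fun l => Pi.single (a l) (1 : ℝ))) • (List.ofFn fun l => nil (u (a l))).prod)
    * ((J.sort (· ≤ ·)).map w).prod

end Grass

open Grass

/-! ### *cs* manifolds -/

/-- A *cs* manifold: a space glued from open subspaces of the affine superspaces
`𝔸^{m|n} = (ℝ^m, C^∞(·, ℂ) ⊗ ⋀ (ℂⁿ)^*)`. The transition morphism from the chart `i` to the chart `j`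
is given by the pullbacks `even i j`, `odd i j` of the coordinates of the chart `j`, which are
even superfunctions with real values, respectively odd superfunctions, on the overlap. -/
structure CSManifold where
  /-- the underlying space -/
  Pt : Type u
  [top : TopologicalSpace Pt]
  /-- the index set of the atlas -/
  Idx : Type v
  /-- even dimension of a chart -/
  m : Idx → ℕ
  /-- odd dimension of a chart -/
  n : Idx → ℕ
  chart : ∀ i, OpenPartialHomeomorph Pt (Fin (m i) → ℝ)
  cover : ∀ x : Pt, ∃ i, x ∈ (chart i).source
  even : ∀ i j, (Fin (m i) → ℝ) → Fin (m j) → Grass (n i)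
  odd : ∀ i j, (Fin (m i) → ℝ) → Fin (n j) → Grass (n i)
  even_smooth : ∀ i j c J,
    ContDiffOn ℝ ∞ (fun s => coef J (even i j s c)) ((chart i).symm.trans (chart j)).source
  odd_smooth : ∀ i j c J,
    ContDiffOn ℝ ∞ (fun s => coef J (odd i j s c)) ((chart i).symm.trans (chart j)).source
  even_isEven : ∀ i j, ∀ s ∈ ((chart i).symm.trans (chart j)).source, ∀ c,
    IsEven (even i j s c)
  odd_isOdd : ∀ i j, ∀ s ∈ ((chart i).symm.trans (chart j)).source, ∀ c,
    IsOdd (odd i j s c)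
  even_body : ∀ i j, ∀ s ∈ ((chart i).symm.trans (chart j)).source, ∀ c,
    coef ∅ (even i j s c) = ((chart j ((chart i).symm s) c : ℝ) : ℂ)
  even_self : ∀ i, ∀ s ∈ (chart i).target, ∀ c,
    even i i s c = algebraMap ℂ (Grass (n i)) ((s c : ℝ) : ℂ)
  odd_self : ∀ i, ∀ s ∈ (chart i).target, ∀ c, odd i i s c = gen c
  even_cocycle : ∀ i j k, ∀ s ∈ ((chart i).symm.trans (chart j)).source,
    s ∈ ((chart i).symm.trans (chart k)).source → ∀ c,
      even i k s c = pull (even i j s) (odd i j s) (fun t => even j k t c)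
  odd_cocycle : ∀ i j k, ∀ s ∈ ((chart i).symm.trans (chart j)).source,
    s ∈ ((chart i).symm.trans (chart k)).source → ∀ c,
      odd i k s c = pull (even i j s) (odd i j s) (fun t => odd j k t c)

attribute [instance] CSManifold.top

namespace CSManifold

/-- A superfunction on `S × V`, where `V` is an open subset of the (purely even) space `E`. In the
chart `i` of `S` it is a smooth function of `(s, x)` with values in `Grass (n i)`; on overlaps
the local expressions correspond under (transition morphism of `S`) `× id_V`, and the pullback along
the latter is the pullback along the transition morphism with the point `x ∈ V` as a parameter. -/
structure Superfun (S : CSManifold.{u, v}) {E : Type w} [NormedAddCommGroup E] [NormedSpace ℝ E]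
    (V : Set E) where
  toFun : ∀ i, (Fin (S.m i) → ℝ) → E → Grass (S.n i)
  smooth : ∀ i J, ContDiffOn ℝ ∞ (fun z : (Fin (S.m i) → ℝ) × E => coef J (toFun i z.1 z.2))
    ((S.chart i).target ×ˢ V)
  compat : ∀ i j, ∀ s ∈ ((S.chart i).symm.trans (S.chart j)).source, ∀ x ∈ V,
    toFun i s x = pull (S.even i j s) (S.odd i j s) (fun t => toFun j t x)

variable {S : CSManifold.{u, v}}

variable (S) in
/-- `Γ(𝒪_S)`, the superfunctions on `S = S × 𝔸⁰`. -/
abbrev BaseFun := S.Superfun (univ : Set (Fin 0 → ℝ))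

variable (S) in
/-- `Γ(𝒪_{S × 𝔸^{p|N}})`, where `𝒪_{S × 𝔸^{p|N}} = 𝒪_{S × 𝔸^p} ⊗ ⋀ (ℂ^N)^*`: the family `(f_I)` is the
superfunction `f = ∑_I ξ^I f_I`, where `ξ_1, …, ξ_N` are the odd coordinates of `𝔸^{p|N}`. -/
abbrev FibreFun (p N : ℕ) := Finset (Fin N) → S.Superfun (univ : Set (Fin p → ℝ))

/-- The support of `f` in `S₀ × ℝ^p`. -/
def FibreFun.support {p N : ℕ} (f : S.FibreFun p N) : Set (S.Pt × (Fin p → ℝ)) :=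
  closure {z | ∃ i, z.1 ∈ (S.chart i).source ∧ ∃ I, (f I).toFun i (S.chart i z.1) z.2 ≠ 0}

/-- `f` is compactly supported in the fibres over `S`: the projection `supp f → S₀` is proper. -/
def FibreFun.FibreCompact {p N : ℕ} (f : S.FibreFun p N) : Prop :=
  IsProperMap (fun z : FibreFun.support f => z.1.1)

/-! ### Berezin fibre integral -/

/-- The Berezin--Lebesgue fibre integral with respect to `|Dλ| = (-2π)^{-q} |D(v, ξ)|`, in the
chart `i` of `S` at the point `s`: the coefficient of `θ^J` is `(-2π)^{-q}` times the integral over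
`v ∈ ℝ^p` of the coefficient of `ξ_1 ⋯ ξ_{2q} θ^J`. -/
def fibreIntegral {p q : ℕ} (f : S.FibreFun p (2 * q)) (i : S.Idx) (s : Fin (S.m i) → ℝ)
    (J : Finset (Fin (S.n i))) : ℂ :=
  (((-2 * Real.pi) ^ q)⁻¹ : ℝ) • ∫ v : Fin p → ℝ, coef J ((f Finset.univ).toFun i s v)

/-- Absolute convergence of the integral above. -/
def FibreIntegrable {p q : ℕ} (f : S.FibreFun p (2 * q)) (i : S.Idx) (s : Fin (S.m i) → ℝ)
    (J : Finset (Fin (S.n i))) : Prop :=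
  Integrable (fun v : Fin p → ℝ => coef J ((f Finset.univ).toFun i s v))

/-- The fibre integral of `f` exists and is the superfunction `h ∈ Γ(𝒪_S)`. -/
def HasFibreIntegral {p q : ℕ} (f : S.FibreFun p (2 * q)) (h : S.BaseFun) : Prop :=
  ∀ i, ∀ s ∈ (S.chart i).target, ∀ J,
    FibreIntegrable f i s J ∧ coef J (h.toFun i s 0) = fibreIntegral f i s J

/-! ### Rotational invariance -/

/-- The odd part `2 (ξ_1 ξ_2 + ξ_3 ξ_4 + ⋯ + ξ_{2q-1} ξ_{2q})` of `‖x‖²`. -/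
def oddNormSq (q : ℕ) : Grass (2 * q) :=
  2 * ∑ j : Fin q, gen (⟨2 * j, by omega⟩ : Fin (2 * q)) * gen ⟨2 * j + 1, by omega⟩

/-- The Taylor expansion `∑_k d_k / k! · (oddNormSq)^k`, with `(oddNormSq)^{q+1} = 0`. If `d_k` is the
`k`-th derivative of a function `h` at `‖v‖² = ∑ v_i²`, this is the value `h(‖x‖²)` at `v` of the
pullback of `h` along `‖·‖²`. -/
def taylorNormSq (q : ℕ) (d : ℕ → ℂ) : Grass (2 * q) :=
  ∑ k ∈ Finset.range (q + 1), (d k / (k ! : ℂ)) • oddNormSq q ^ k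

/-- `∑_I f_{IJ} ξ^I`, the coefficient of `θ^J` in `f` at the point `(s, v)`, in the chart `i`. -/
def FibreFun.oddCoef {p N : ℕ} (f : S.FibreFun p N) (i : S.Idx) (s : Fin (S.m i) → ℝ)
    (v : Fin p → ℝ) (J : Finset (Fin (S.n i))) : Grass N :=
  ∑ I, coef J ((f I).toFun i s v) • Grass.basis N I

/-- `f` is rotationally invariant over `S` with radial profile `f° = fo`.
If `p > 0`: `fo` is a superfunction on `S × (-ε, ∞)` with `f(s, x) = fo(s, ‖x‖)` on
`S × 𝔸^{p|2q}_{≠0}`; since `‖x‖ = √(‖x‖²)`, this is the pullback of `r ↦ fo(s, √r)` along `‖·‖²`.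
If `p = 0`: `f(s, x) = g(s, ‖x‖²)` for a superfunction `g` on `S × 𝔸¹`, and `fo(s, t) = g(s, t²)`. -/
def FibreFun.HasProfile {p q : ℕ} (f : S.FibreFun p (2 * q))
    (fo : ∀ i, (Fin (S.m i) → ℝ) → ℝ → Grass (S.n i)) : Prop :=
  (0 < p ∧ ∃ ε : ℝ, 0 < ε ∧ ∃ F : S.Superfun (Ioi (-ε)), F.toFun = fo ∧
    ∀ i, ∀ s ∈ (S.chart i).target, ∀ v : Fin p → ℝ, v ≠ 0 → ∀ J,
      FibreFun.oddCoef f i s v J = taylorNormSq q fun k =>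
        iteratedDeriv k (fun r : ℝ => coef J (fo i s (√r))) (∑ c, v c ^ 2)) ∨
  (p = 0 ∧ ∃ G : S.Superfun (univ : Set ℝ),
    (∀ i, ∀ s ∈ (S.chart i).target, ∀ v : Fin p → ℝ, ∀ J,
      FibreFun.oddCoef f i s v J = taylorNormSq q fun k =>
        iteratedDeriv k (fun r : ℝ => coef J (G.toFun i s r)) (∑ c, v c ^ 2)) ∧
    ∀ i, ∀ s ∈ (S.chart i).target, ∀ t : ℝ, fo i s t = G.toFun i s (t ^ 2))

/-- `f'` is the superfunction `(s, x) ↦ fo(s, ‖x‖)` on all of `S × 𝔸^{p|2q}`, i.e. the pullback along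
`‖·‖²` of `r ↦ fo(s, √r)`, `r ∈ [0, ∞)` (for `p = 0` only the derivatives at `r = 0` enter). -/
def FibreFun.IsRadial {p q : ℕ} (f' : S.FibreFun p (2 * q))
    (fo : ∀ i, (Fin (S.m i) → ℝ) → ℝ → Grass (S.n i)) : Prop :=
  ∀ i, ∀ s ∈ (S.chart i).target, ∀ v : Fin p → ℝ, ∀ J,
    FibreFun.oddCoef f' i s v J = taylorNormSq q fun k =>
      iteratedDerivWithin k (fun r : ℝ => coef J (fo i s (√r))) (Ici 0) (∑ c, v c ^ 2)

end CSManifold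

end

/-! Write H(r) = f°(s, √r) for one θ-coefficient of the profile. Since ‖x‖² = ‖v‖² + ‖ξ‖² with ‖ξ‖²
nilpotent, f is the finite Taylor expansion of H at ‖v‖² in powers of ‖ξ‖². The exterior degree
separates its terms: degree 2l sees only H^(l). The top power is ‖ξ‖^{2q} = 2^q q! ξ_1⋯ξ_{2q}, so
the Berezin integral is (-π)^{-q} ∫ H^(q)(‖v‖²) dv (`FibreFun.IsRadial.fibreIntegral_eq`). Polar
coordinates with r = ‖v‖² give the formula for arbitrary support; for p = 0 the integral is
evaluation at 0.

For compact support, integration by parts in r lowers (p + 2, q + 1) to (p, q). The constants match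
because Γ(p/2 + 1) = (p/2) Γ(p/2), and for p = 0 the boundary term at 0 becomes the evaluation
(`radialIntegral_add_two`). Hence only p - 2q and H matter, and the three closed formulas are the
values at (p - 2q, 0), (0, n) and (1, n). The form with derivatives of f° itself compares Taylor
coefficients of f°(t) = H(t²).

Two analytic points remain. For p > 0, H is a priori only continuous at 0; smoothness of the
coefficients of f at v = 0 gives H^(l) a limit at 0 for every l ≤ q, so H is C^q on [0, ∞)
(`contDiffOn_sqrtCoef_of_radial`). The integral is a superfunction because properness bounds the
fibre supports locally uniformly: one may differentiate under the integral, and pullback along a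
transition morphism, a finite sum of derivatives, commutes with it (`Grass.pull_integral`). -/

section

open CSManifold

namespace Grass

/-! ### Powers of the odd part of `‖x‖²` -/

theorem coef_smul {n : ℕ} (J : Finset (Fin n)) (c : ℂ) (a : Grass n) :
    coef J (c • a) = c * coef J a := by
  simp [coef]

theorem coef_sum {n : ℕ} {α : Type*} (J : Finset (Fin n)) (t : Finset α) (a : α → Grass n) :
    coef J (∑ x ∈ t, a x) = ∑ x ∈ t, coef J (a x) := by
  simp [coef]

theorem coef_basis {n : ℕ} (I J : Finset (Fin n)) :
    coef J (basis n I) = if I = J then 1 else 0 := by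
  simp [coef, Finsupp.single_apply]

theorem coef_sum_smul_basis {n : ℕ} (c : Finset (Fin n) → ℂ) (I : Finset (Fin n)) :
    coef I (∑ J, c J • basis n J) = c I := by
  simp [coef_sum, coef_smul, coef_basis]

theorem ext_coef {n : ℕ} {a b : Grass n} (h : ∀ J, coef J a = coef J b) : a = b :=
  (basis n).ext_elem h

/-- The induced basis of `⋀^m` consists of the `θ^J` with `J.card = m`. This grading is what
separates the terms of the Taylor expansion. -/
theorem coef_eq_zero_of_mem_exteriorPower {n m : ℕ} {a : Grass n}
    (ha : a ∈ (⋀[ℂ]^m (Fin n → ℂ))) {I : Finset (Fin n)} (hI : I.card ≠ m) : coef I a = 0 := by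
  have h := congrArg Subtype.val (((Pi.basisFun ℂ (Fin n)).exteriorPower m).sum_repr ⟨a, ha⟩)
  change _ = a at h
  rw [← h]
  simp only [AddSubmonoidClass.coe_finsetSum, Submodule.coe_smul, coef_sum, coef_smul]
  refine Finset.sum_eq_zero fun t _ => ?_
  rw [← ExteriorAlgebra.basis_eq_coe_basis]
  change _ * coef I (basis n t) = 0
  rw [coef_basis, if_neg, mul_zero]
  rintro rfl
  exact hI t.2

theorem gen_mem {n : ℕ} (j : Fin n) : gen j ∈ (⋀[ℂ]^1 (Fin n → ℂ)) := by
  simp [gen, ExteriorAlgebra.exteriorPower]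

theorem oddNormSq_mem (q : ℕ) : oddNormSq q ∈ (⋀[ℂ]^2 (Fin (2 * q) → ℂ)) := by
  have h : oddNormSq q = (2 : ℂ) •
      ∑ j : Fin q, gen (⟨2 * j, by omega⟩ : Fin (2 * q)) * gen ⟨2 * j + 1, by omega⟩ := by
    rw [oddNormSq, ofNat_smul_eq_nsmul, nsmul_eq_mul]
    rfl
  rw [h]
  refine Submodule.smul_mem _ _ (Submodule.sum_mem _ fun j _ => ?_)
  exact SetLike.mul_mem_graded (A := fun m => ⋀[ℂ]^m (Fin (2 * q) → ℂ)) (gen_mem _) (gen_mem _)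

theorem coef_oddNormSq_pow_eq_zero {q k : ℕ} {I : Finset (Fin (2 * q))} (hI : I.card ≠ 2 * k) :
    coef I (oddNormSq q ^ k) = 0 := by
  refine coef_eq_zero_of_mem_exteriorPower (m := k * 2) ?_ (by omega)
  exact SetLike.pow_mem_graded (A := fun m => ⋀[ℂ]^m (Fin (2 * q) → ℂ)) k (oddNormSq_mem q)

theorem add_pow_succ_of_sq_zero {R : Type*} [Ring R] {a e : R} (hc : Commute a e)
    (he : e * e = 0) (n : ℕ) : (a + e) ^ (n + 1) = a ^ (n + 1) + (n + 1 : R) * (a ^ n * e) := by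
  induction n with
  | zero => simp
  | succ n ih =>
    have h1 : a ^ n * e * a = a ^ (n + 1) * e := by
      rw [mul_assoc, ← hc.eq, ← mul_assoc, pow_succ]
    have h2 : a ^ n * e * e = 0 := by rw [mul_assoc, he, mul_zero]
    rw [pow_succ, ih, add_mul, mul_add, mul_add, mul_assoc _ _ a, mul_assoc _ _ e, h1, h2]
    push_cast
    rw [← pow_succ]
    noncomm_ring

theorem gen_mul_gen {n : ℕ} (i j : Fin n) : gen i * gen j = -(gen j * gen i) :=
  eq_neg_of_add_eq_zero_left (ExteriorAlgebra.ι_add_mul_swap _ _)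

theorem gen_mul_self {n : ℕ} (i : Fin n) : gen i * gen i = 0 :=
  ExteriorAlgebra.ι_sq_zero _

theorem commute_gen_mul_gen {n : ℕ} (i j k l : Fin n) :
    Commute (gen i * gen j) (gen k * gen l) := by
  have h : ∀ m : Fin n, gen i * gen j * gen m = gen m * (gen i * gen j) := fun m => by
    rw [mul_assoc, gen_mul_gen j m, mul_neg, ← mul_assoc, gen_mul_gen i m, neg_mul, neg_neg,
      mul_assoc]
  rw [Commute, SemiconjBy, ← mul_assoc, h, mul_assoc, h, mul_assoc]

theorem gen_pair_sq {n : ℕ} (i j : Fin n) : gen i * gen j * (gen i * gen j) = 0 := by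
  rw [mul_assoc, ← mul_assoc (gen j), gen_mul_gen j i]
  simp only [neg_mul, mul_neg]
  rw [mul_assoc, gen_mul_self, mul_zero, mul_zero, neg_zero]

/-- A sum of `m` commuting elements of square zero has `m`-th power `m!` times their product. -/
theorem sum_pow_of_sq_zero {R : Type*} [Ring R] {m : ℕ} (e : Fin m → R)
    (hc : ∀ i j, Commute (e i) (e j)) (he : ∀ i, e i * e i = 0) :
    (∑ i, e i) ^ m = (m ! : R) * (List.ofFn e).prod ∧ (∑ i, e i) ^ (m + 1) = 0 := by
  induction m with
  | zero => simp
  | succ m ih =>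
    obtain ⟨h1, h2⟩ := ih (fun i => e i.castSucc) (fun _ _ => hc _ _) fun _ => he _
    have hs : Commute (∑ i : Fin m, e i.castSucc) (e (Fin.last m)) :=
      Commute.sum_left _ _ _ fun _ _ => hc _ _
    rw [Fin.sum_univ_castSucc]
    refine ⟨?_, ?_⟩
    · rw [add_pow_succ_of_sq_zero hs (he _), h2, zero_add, h1, List.ofFn_succ', List.prod_concat,
        Nat.factorial_succ]
      push_cast
      rw [mul_assoc, mul_assoc]
    · rw [add_pow_succ_of_sq_zero hs (he _), pow_succ, h2]
      simp

/-- Used with `gen` to recognise the product of all pairs as the top basis monomial. -/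
theorem prod_ofFn_pairs {R : Type*} [Monoid R] {q : ℕ} (g : Fin (2 * q) → R) :
    (List.ofFn fun j : Fin q => g ⟨2 * j, by omega⟩ * g ⟨2 * j + 1, by omega⟩).prod =
      (List.ofFn g).prod := by
  induction q with
  | zero => simp
  | succ q ih =>
    have := ih fun i => g ⟨i, by omega⟩
    rw [List.ofFn_succ', List.prod_concat]
    change (List.ofFn fun j : Fin q => g ⟨2 * j, by omega⟩ * g ⟨2 * j + 1, by omega⟩).prod * _ = _
    rw [this]
    have h2 : List.ofFn g = List.ofFn (n := 2 * q + 1 + 1) g := rfl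
    rw [h2, List.ofFn_succ', List.prod_concat, List.ofFn_succ', List.prod_concat, mul_assoc]
    rfl

theorem basis_univ (n : ℕ) : basis n Finset.univ = (List.ofFn (gen (n := n))).prod := by
  rw [basis, ExteriorAlgebra.basis_apply_ofCard _ (n := n) (by simp), ExteriorAlgebra.ιMulti_family,
    ExteriorAlgebra.ιMulti_apply]
  congr 2
  funext i
  have h : (Finset.univ : Finset (Fin n)).orderEmbOfFin (k := n) (by simp) =
      RelEmbedding.refl _ := (Finset.orderEmbOfFin_unique' _ fun _ => Finset.mem_univ _).symm
  have h2 : (Set.powersetCard.ofFinEmbEquiv.symm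
      (Set.powersetCard.ofCard (s := (Finset.univ : Finset (Fin n))) (n := n)
        (by simp))) i = i := by
    rw [Set.powersetCard.ofFinEmbEquiv_symm_apply]
    exact DFunLike.congr_fun h i
  simp only [gen, Function.comp_apply, h2, Pi.basisFun_apply]

/-- The pairs commute and square to zero, so only the product of all of them survives. The `q!` will
cancel the Taylor denominator, and `2^q` turns `(-2π)^{-q}` into `(-π)^{-q}`. -/
theorem coef_univ_oddNormSq_pow (q : ℕ) :
    coef Finset.univ (oddNormSq q ^ q) = 2 ^ q * (q ! : ℂ) := by
  have h := (sum_pow_of_sq_zero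
    (fun j : Fin q => gen (⟨2 * j, by omega⟩ : Fin (2 * q)) * gen ⟨2 * j + 1, by omega⟩)
    (fun _ _ => commute_gen_mul_gen _ _ _ _) fun _ => gen_pair_sq _ _).1
  rw [prod_ofFn_pairs, ← basis_univ] at h
  have h2 : oddNormSq q ^ q = (2 ^ q * (q ! : ℂ)) • basis (2 * q) Finset.univ := by
    rw [oddNormSq, (Commute.ofNat_left 2 _).mul_pow, h, Algebra.smul_def]
    simp only [map_mul, map_pow, map_natCast, map_ofNat, mul_assoc]
  rw [h2, coef_smul, coef_basis, if_pos rfl, mul_one]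

/-- The `l`-th power divides the `q`-th, which is nonzero. A nonzero coefficient lets the `l`-th
derivative of the profile be recovered from the superfunction. -/
theorem exists_coef_oddNormSq_pow_ne_zero {q l : ℕ} (hl : l ≤ q) :
    ∃ I, coef I (oddNormSq q ^ l) ≠ 0 := by
  by_contra! h
  have h0 : oddNormSq q ^ l = 0 := ext_coef fun J => by rw [h]; simp [coef]
  have := coef_univ_oddNormSq_pow q
  rw [show oddNormSq q ^ q = oddNormSq q ^ (q - l) * oddNormSq q ^ l by
    rw [← pow_add, Nat.sub_add_cancel hl], h0, mul_zero] at this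
  have h3 : (2 : ℂ) ^ q * (q ! : ℂ) ≠ 0 :=
    mul_ne_zero (by simp) (by exact_mod_cast q.factorial_ne_zero)
  exact h3 (this.symm.trans (by simp [coef]))

theorem coef_taylorNormSq {q l : ℕ} (hl : l ≤ q) (d : ℕ → ℂ) {I : Finset (Fin (2 * q))}
    (hI : I.card = 2 * l) :
    coef I (taylorNormSq q d) = d l / (l ! : ℂ) * coef I (oddNormSq q ^ l) := by
  rw [taylorNormSq, coef_sum, Finset.sum_eq_single_of_mem l (by simpa using by omega)]
  · rw [coef_smul]
  · intro k _ hk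
    rw [coef_smul, coef_oddNormSq_pow_eq_zero (by omega), mul_zero]

theorem coef_univ_taylorNormSq (q : ℕ) (d : ℕ → ℂ) :
    coef Finset.univ (taylorNormSq q d) = 2 ^ q * d q := by
  rw [coef_taylorNormSq le_rfl _ (by simp), coef_univ_oddNormSq_pow]
  have : (q ! : ℂ) ≠ 0 := by exact_mod_cast q.factorial_ne_zero
  field_simp

end Grass

namespace CSManifold

variable {S : CSManifold.{u, v}}

theorem FibreFun.coef_oddCoef {p N : ℕ} (f : S.FibreFun p N) (i : S.Idx) (s : Fin (S.m i) → ℝ)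
    (v : Fin p → ℝ) (J : Finset (Fin (S.n i))) (I : Finset (Fin N)) :
    Grass.coef I (FibreFun.oddCoef f i s v J) = Grass.coef J ((f I).toFun i s v) := by
  rw [FibreFun.oddCoef, Grass.coef_sum_smul_basis]

end CSManifold

end

section

open Filter Topology

/-! ### One-sided derivatives on the half-line -/

theorem iteratedDerivWithin_Ici_eq {H : ℝ → ℂ} (hH : ContDiffOn ℝ ∞ H (Ioi 0)) (k : ℕ) {r : ℝ}
    (hr : 0 < r) : iteratedDerivWithin k H (Ici 0) r = iteratedDeriv k H r :=
  iteratedDerivWithin_eq_iteratedDeriv (uniqueDiffOn_Ici 0)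
    ((hH.contDiffAt (Ioi_mem_nhds hr)).of_le (mod_cast le_top)) hr.le

theorem ContDiffOn.hasDerivAt_iteratedDeriv_of_Ioi {H : ℝ → ℂ} (hH : ContDiffOn ℝ ∞ H (Ioi 0))
    (k : ℕ) {r : ℝ} (hr : 0 < r) :
    HasDerivAt (iteratedDeriv k H) (iteratedDeriv (k + 1) H r) r := by
  have h1 : DifferentiableAt ℝ (iteratedDeriv k H) r := by
    have := (hH.contDiffAt (Ioi_mem_nhds hr)).differentiableAt_iteratedFDeriv (m := k)
      (mod_cast WithTop.coe_lt_top _)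
    rwa [iteratedFDeriv_eq_equiv_comp, LinearIsometryEquiv.comp_differentiableAt_iff] at this
  have h := h1.hasDerivAt
  rwa [← iteratedDeriv_succ] at h

theorem hasDerivAt_iteratedDerivWithin_Ici {H : ℝ → ℂ} (hH : ContDiffOn ℝ ∞ H (Ioi 0)) (k : ℕ)
    {r : ℝ} (hr : 0 < r) :
    HasDerivAt (iteratedDerivWithin k H (Ici 0)) (iteratedDerivWithin (k + 1) H (Ici 0) r) r := by
  rw [iteratedDerivWithin_Ici_eq hH _ hr]
  refine (hH.hasDerivAt_iteratedDeriv_of_Ioi k hr).congr_of_eventuallyEq ?_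
  filter_upwards [Ioi_mem_nhds hr] with x hx using iteratedDerivWithin_Ici_eq hH k hx

/-- If the derivatives of `H` up to order `n` on `(0, ∞)` have limits at `0`, then `H` is `C^n` on
`[0, ∞)` and its one-sided derivatives at `0` are these limits. -/
theorem contDiffOn_Ici_of_tendsto_iteratedDeriv {H : ℝ → ℂ} (hH : ContDiffOn ℝ ∞ H (Ioi 0))
    (h0 : ContinuousWithinAt H (Ici 0) 0) {n : ℕ} {L : ℕ → ℂ}
    (hL : ∀ k ≤ n, Tendsto (iteratedDeriv k H) (𝓝[>] 0) (𝓝 (L k))) :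
    ContDiffOn ℝ n H (Ici 0) ∧ ∀ k ≤ n, iteratedDerivWithin k H (Ici 0) 0 = L k := by
  have hev : ∀ k, iteratedDerivWithin k H (Ici 0) =ᶠ[𝓝[>] 0] iteratedDeriv k H := fun k => by
    filter_upwards [self_mem_nhdsWithin] with x hx using iteratedDerivWithin_Ici_eq hH k hx
  have hL' : ∀ k ≤ n, Tendsto (iteratedDerivWithin k H (Ici 0)) (𝓝[>] 0) (𝓝 (L k)) :=
    fun k hk => (hL k hk).congr' (hev k).symm
  -- The two clauses feed each other: the value at order `k` gives continuity at 0, hence a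
  -- one-sided derivative equal to the limit of the derivatives, which is the value at order `k +
  -- 1`.
  have hval : ∀ k ≤ n, iteratedDerivWithin k H (Ici 0) 0 = L k ∧
      (k < n → HasDerivWithinAt (iteratedDerivWithin k H (Ici 0)) (L (k + 1)) (Ici 0) 0) := by
    intro k
    have hder : ∀ k < n, iteratedDerivWithin k H (Ici 0) 0 = L k →
        HasDerivWithinAt (iteratedDerivWithin k H (Ici 0)) (L (k + 1)) (Ici 0) 0 := by
      intro k hk hk0
      refine hasDerivWithinAt_Ici_of_tendsto_deriv (s := Ioi 0) ?_ ?_ self_mem_nhdsWithin ?_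
      · exact fun x hx =>
          (hasDerivAt_iteratedDerivWithin_Ici hH k hx).differentiableAt.differentiableWithinAt
      · rw [ContinuousWithinAt, hk0]
        exact hL' k hk.le
      · refine (hL' (k + 1) hk).congr' ?_
        filter_upwards [self_mem_nhdsWithin] with x hx
        exact (hasDerivAt_iteratedDerivWithin_Ici hH k hx).deriv.symm
    induction k with
    | zero =>
      intro hk
      have h1 : iteratedDerivWithin 0 H (Ici 0) 0 = L 0 := by
        have h2 := hL' 0 hk
        rw [iteratedDerivWithin_zero] at h2 ⊢
        exact tendsto_nhds_unique (h0.tendsto.mono_left (nhdsWithin_mono _ Ioi_subset_Ici_self)) h2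
      exact ⟨h1, fun h => hder 0 h h1⟩
    | succ k ih =>
      intro hk
      have h1 : iteratedDerivWithin (k + 1) H (Ici 0) 0 = L (k + 1) := by
        rw [iteratedDerivWithin_succ]
        exact ((ih (by omega)).2 (by omega)).derivWithin (uniqueDiffOn_Ici 0 0 self_mem_Ici)
      exact ⟨h1, fun h => hder _ h h1⟩
  refine ⟨?_, fun k hk => (hval k hk).1⟩
  rw [contDiffOn_nat_iff_continuousOn_differentiableOn_deriv (uniqueDiffOn_Ici 0)]
  refine ⟨fun k hk x hx => ?_, fun k hk x hx => ?_⟩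
  · rcases (mem_Ici.1 hx).eq_or_lt with rfl | hx
    · rw [← continuousWithinAt_Ioi_iff_Ici, ContinuousWithinAt, (hval k hk).1]
      exact hL' k hk
    · exact (hasDerivAt_iteratedDerivWithin_Ici hH k hx).continuousAt.continuousWithinAt
  · rcases (mem_Ici.1 hx).eq_or_lt with rfl | hx
    · exact ((hval k hk.le).2 hk).differentiableWithinAt
    · exact (hasDerivAt_iteratedDerivWithin_Ici hH k hx).differentiableAt.differentiableWithinAt

theorem iteratedDerivWithin_Ici_eq_zero {H : ℝ → ℂ} {B : ℝ} (hB : ∀ r, B < r → H r = 0) (k : ℕ)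
    {r : ℝ} (hr : B < r) : iteratedDerivWithin k H (Ici 0) r = 0 := by
  induction k generalizing r with
  | zero => simpa using hB r hr
  | succ k ih =>
    rw [iteratedDerivWithin_succ]
    have : iteratedDerivWithin k H (Ici 0) =ᶠ[𝓝[Ici 0] r] fun _ => 0 :=
      (eventually_of_mem (Ioi_mem_nhds hr) fun x hx => ih hx).filter_mono nhdsWithin_le_nhds
    rw [this.derivWithin_eq (ih hr)]
    simp

/-! ### Radial integrals -/

theorem integrableOn_rpow_smul {a : ℝ} (ha : -1 < a) {u : ℝ → ℂ} (hu : ContinuousOn u (Ici 0))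
    {B : ℝ} (hB : ∀ r, B < r → u r = 0) : IntegrableOn (fun r => r ^ a • u r) (Ioi 0) := by
  have h1 : IntegrableOn (fun r => r ^ a • u r) (Ioc 0 (max B 0)) := by
    have h2 : IntegrableOn (fun r : ℝ => r ^ a) (Icc 0 (max B 0)) := by
      rw [integrableOn_Icc_iff_integrableOn_Ioc,
        ← intervalIntegrable_iff_integrableOn_Ioc_of_le (le_max_right _ _)]
      exact intervalIntegral.intervalIntegrable_rpow' ha
    exact (h2.smul_continuousOn (hu.mono Icc_subset_Ici_self) isCompact_Icc).mono_set
      Ioc_subset_Icc_self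
  rw [← Ioc_union_Ioi_eq_Ioi (le_max_right B 0)]
  refine h1.union ((integrableOn_congr_fun (fun r hr => ?_) measurableSet_Ioi).2
    integrableOn_zero)
  simp [hB r ((le_max_left _ _).trans_lt hr)]

/-- Integration by parts: the boundary term of `r ^ a • w r` vanishes at 0 because `a > 0`, and at
infinity because `w` does. -/
theorem integral_rpow_smul_deriv {a : ℝ} (ha : 0 < a) {w w' : ℝ → ℂ}
    (hw : ContinuousOn w (Ici 0)) (hw' : ContinuousOn w' (Ici 0))
    (hd : ∀ r, 0 < r → HasDerivAt w (w' r) r) {B : ℝ} (hB : ∀ r, B < r → w r = 0)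
    (hB' : ∀ r, B < r → w' r = 0) :
    ∫ r in Ioi (0 : ℝ), r ^ a • w' r = -(a • ∫ r in Ioi (0 : ℝ), r ^ (a - 1) • w r) := by
  have i1 := integrableOn_rpow_smul (by linarith : -1 < a) hw' hB'
  have i2 := integrableOn_rpow_smul (by linarith : -1 < a - 1) hw hB
  have h := integral_Ioi_of_hasDerivAt_of_tendsto (a := 0) (m := 0) (f := fun r : ℝ => r ^ a • w r)
    (f' := fun r : ℝ => r ^ a • w' r + a • (r ^ (a - 1) • w r)) ?_ ?_ (i1.add (i2.smul a)) ?_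
  · rw [integral_add i1 (g := fun r : ℝ => a • (r ^ (a - 1) • w r)) (i2.smul a),
      integral_smul, Real.zero_rpow ha.ne', zero_smul,
      sub_zero] at h
    exact eq_neg_of_add_eq_zero_left h
  · exact (Real.continuousAt_rpow_const 0 a (Or.inr ha.le)).continuousWithinAt.smul
      (hw 0 self_mem_Ici)
  · intro r hr
    have := (Real.hasDerivAt_rpow_const (p := a) (Or.inl (ne_of_gt hr))).smul (hd r hr)
    rwa [mul_smul] at this
  · refine tendsto_const_nhds.congr' ?_
    filter_upwards [Ioi_mem_atTop B] with r hr
    simp [hB r hr]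

/-- The case `a = 0` of the integration by parts, where the boundary term at 0 survives. It accounts
for the passage from `𝔸^{2|2q+2}` to `𝔸^{0|2q}`. -/
theorem integral_deriv_Ioi_of_eq_zero {w w' : ℝ → ℂ}
    (hw : ContinuousOn w (Ici 0)) (hw' : ContinuousOn w' (Ici 0))
    (hd : ∀ r, 0 < r → HasDerivAt w (w' r) r) {B : ℝ} (hB : ∀ r, B < r → w r = 0)
    (hB' : ∀ r, B < r → w' r = 0) :
    ∫ r in Ioi (0 : ℝ), w' r = -w 0 := by
  have i1 := integrableOn_rpow_smul (by norm_num : (-1 : ℝ) < 0) hw' hB'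
  simp only [Real.rpow_zero, one_smul] at i1
  rw [integral_Ioi_of_hasDerivAt_of_tendsto (m := 0) (hw 0 self_mem_Ici) hd i1, zero_sub]
  refine tendsto_const_nhds.congr' ?_
  filter_upwards [Ioi_mem_atTop B] with r hr
  simp [hB r hr]

/-- The value of the Berezin integral on `𝔸^{p|2q}` of the rotationally invariant superfunction
`H(‖x‖²)`. -/
noncomputable def radialIntegral (p q : ℕ) (H : ℝ → ℂ) : ℂ :=
  (-Real.pi) ^ (-(q : ℤ)) • if p = 0 then iteratedDerivWithin q H (Ici 0) 0 else
    (Real.pi ^ ((p : ℝ) / 2) / Real.Gamma ((p : ℝ) / 2)) •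
      ∫ r in Ioi (0 : ℝ), r ^ ((p : ℝ) / 2 - 1) • iteratedDerivWithin q H (Ici 0) r

/-- One integration by parts. The sign cancels that of `(-π)⁻¹`, the extra factor `π` of the sphere
constant cancels its modulus, and `p / 2` is absorbed by the functional equation of `Γ`. -/
theorem radialIntegral_add_two {H : ℝ → ℂ} (hH : ContDiffOn ℝ ∞ H (Ioi 0)) {p q : ℕ}
    (hq : ContDiffOn ℝ (q + 1 : ℕ) H (Ici 0)) {B : ℝ} (hB : ∀ r, B < r → H r = 0) :
    radialIntegral (p + 2) (q + 1) H = radialIntegral p q H := by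
  have c0 := hq.continuousOn_iteratedDerivWithin (m := q) (by norm_cast; omega)
    (uniqueDiffOn_Ici 0)
  have c1 := hq.continuousOn_iteratedDerivWithin (m := q + 1) le_rfl (uniqueDiffOn_Ici 0)
  have hd := fun r (hr : 0 < r) => hasDerivAt_iteratedDerivWithin_Ici hH q hr
  have z0 := fun r hr => iteratedDerivWithin_Ici_eq_zero hB q (r := r) hr
  have z1 := fun r hr => iteratedDerivWithin_Ici_eq_zero hB (q + 1) (r := r) hr
  have hpi := Real.pi_pos.ne'
  have hz : (-Real.pi) ^ (-((q + 1 : ℕ) : ℤ)) = (-Real.pi) ^ (-(q : ℤ)) * (-Real.pi)⁻¹ := by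
    rw [Nat.cast_succ, neg_add, zpow_add₀ (neg_ne_zero.2 hpi), zpow_neg_one]
  rw [radialIntegral, radialIntegral, if_neg (by omega), hz, mul_smul]
  congr 1
  have e1 : (((p + 2 : ℕ) : ℝ) / 2 - 1) = (p : ℝ) / 2 := by push_cast; ring
  have e2 : (((p + 2 : ℕ) : ℝ) / 2) = (p : ℝ) / 2 + 1 := by push_cast; ring
  rw [e1, e2]
  split_ifs with hp
  · subst hp
    simp only [Nat.cast_zero, zero_div, Real.rpow_zero, one_smul, zero_add, Real.rpow_one,
      Real.Gamma_one, div_one]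
    rw [integral_deriv_Ioi_of_eq_zero c0 c1 hd z0 z1, smul_neg, smul_neg, smul_smul, inv_neg,
      neg_mul, inv_mul_cancel₀ hpi, neg_smul, one_smul, neg_neg]
  · have hp' : 0 < (p : ℝ) / 2 := by positivity
    rw [integral_rpow_smul_deriv hp' c0 c1 hd z0 z1, smul_neg, smul_neg, smul_smul, smul_smul,
      ← neg_smul]
    congr 1
    rw [Real.Gamma_add_one hp'.ne', Real.rpow_add_one hpi]
    have := (Real.Gamma_pos_of_pos hp').ne'
    field_simp

theorem radialIntegral_add {H : ℝ → ℂ} (hH : ContDiffOn ℝ ∞ H (Ioi 0)) {p q k : ℕ}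
    (hq : ContDiffOn ℝ (q + k : ℕ) H (Ici 0)) {B : ℝ} (hB : ∀ r, B < r → H r = 0) :
    radialIntegral (p + 2 * k) (q + k) H = radialIntegral p q H := by
  induction k with
  | zero => rfl
  | succ k ih =>
    rw [← ih (hq.of_le (by norm_cast; omega))]
    exact radialIntegral_add_two hH hq hB

/-! ### Polar coordinates in the variable `r = ‖v‖²` -/

section Polar

variable {p : ℕ}

theorem sum_sq_eq_norm_sq (x : EuclideanSpace ℝ (Fin p)) : ∑ c, x c ^ 2 = ‖x‖ ^ 2 := by
  rw [EuclideanSpace.norm_sq_eq]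
  simp

theorem rpow_smul_comp_sq (F : ℝ → ℂ) (hp : 0 < p) {y : ℝ} (hy : 0 < y) :
    y ^ ((2 : ℝ) - 1) • ((y ^ (2 : ℝ)) ^ ((p : ℝ) / 2 - 1) • F (y ^ (2 : ℝ))) =
      y ^ (p - 1) • F (y ^ 2) := by
  rw [smul_smul, ← Real.rpow_mul hy.le, ← Real.rpow_add hy, ← Real.rpow_natCast, Nat.cast_sub hp,
    Real.rpow_two]
  congr 2
  push_cast
  ring

theorem integrable_comp_sum_sq_iff (hp : 0 < p) (F : ℝ → ℂ) :
    Integrable (fun v : Fin p → ℝ => F (∑ c, v c ^ 2)) ↔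
      IntegrableOn (fun r : ℝ => r ^ ((p : ℝ) / 2 - 1) • F r) (Ioi 0) := by
  have : Nonempty (Fin p) := ⟨⟨0, hp⟩⟩
  rw [← (PiLp.volume_preserving_ofLp (Fin p)).integrable_comp_emb
    (MeasurableEquiv.toLp 2 (Fin p → ℝ)).symm.measurableEmbedding]
  have h := integrable_fun_norm_addHaar (volume : Measure (EuclideanSpace ℝ (Fin p)))
    (f := fun y => F (y ^ 2))
  simp only [finrank_euclideanSpace, Fintype.card_fin] at h
  rw [← integrableOn_Ioi_comp_rpow_iff' _ two_ne_zero,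
    integrableOn_congr_fun (show EqOn _ (fun y => y ^ (p - 1) • F (y ^ 2)) (Ioi 0) from
      fun y hy => rpow_smul_comp_sq F hp hy) measurableSet_Ioi, ← h]
  simp only [Function.comp_def, sum_sq_eq_norm_sq]

theorem integral_comp_sum_sq (hp : 0 < p) (F : ℝ → ℂ) :
    ∫ v : Fin p → ℝ, F (∑ c, v c ^ 2) = (Real.pi ^ ((p : ℝ) / 2) / Real.Gamma ((p : ℝ) / 2)) •
      ∫ r in Ioi (0 : ℝ), r ^ ((p : ℝ) / 2 - 1) • F r := by
  have : Nonempty (Fin p) := ⟨⟨0, hp⟩⟩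
  rw [← (PiLp.volume_preserving_ofLp (Fin p)).integral_comp
    (MeasurableEquiv.toLp 2 (Fin p → ℝ)).symm.measurableEmbedding]
  simp only [sum_sq_eq_norm_sq]
  rw [integral_fun_norm_addHaar volume (fun y => F (y ^ 2))]
  rw [← integral_comp_rpow_Ioi_of_pos
    (g := fun r : ℝ => r ^ ((p : ℝ) / 2 - 1) • F r) two_pos]
  simp only [mul_smul]
  rw [integral_smul, setIntegral_congr_fun measurableSet_Ioi
    (fun y hy => rpow_smul_comp_sq F hp hy)]
  simp only [finrank_euclideanSpace, Fintype.card_fin]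
  -- The sphere has area `p` times the volume `π^{p/2} / Γ(p/2 + 1)` of the ball, that is `2 π^{p/2}
  -- / Γ(p/2)`; the Jacobian of `r = y²` accounts for the 2.
  rw [Measure.real, EuclideanSpace.volume_ball, Fintype.card_fin, smul_smul,
    ← Nat.cast_smul_eq_nsmul ℝ, smul_smul]
  congr 1
  have hp' : 0 < (p : ℝ) / 2 := by positivity
  have := (Real.Gamma_pos_of_pos hp')
  rw [Real.Gamma_add_one hp'.ne']
  have h1 : √Real.pi ^ p = Real.pi ^ ((p : ℝ) / 2) := by
    rw [Real.sqrt_eq_rpow, ← Real.rpow_natCast, ← Real.rpow_mul Real.pi_pos.le]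
    congr 1
    ring
  rw [h1, ENNReal.ofReal_one, one_pow, one_mul, ENNReal.toReal_ofReal (by positivity)]
  field_simp

end Polar

/-! ### Even Taylor expansions -/

/-- Uniqueness of one-sided Taylor coefficients: the limit at 0 kills the constant term, and
division by `t` lowers the degree. -/
theorem eq_zero_of_sum_pow_isLittleO {n : ℕ} {c : ℕ → ℂ}
    (h : (fun t : ℝ => ∑ k ∈ Finset.range (n + 1), t ^ k • c k) =o[𝓝[>] 0] fun t => t ^ n) :
    ∀ k ≤ n, c k = 0 := by
  induction n generalizing c with
  | zero =>
    intro k hk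
    obtain rfl : k = 0 := by omega
    simpa [Asymptotics.isLittleO_const_const_iff] using h
  | succ n ih =>
    have h0 : c 0 = 0 := by
      have h1 : Tendsto (fun t : ℝ => ∑ k ∈ Finset.range (n + 1 + 1), t ^ k • c k) (𝓝[>] 0)
          (𝓝 0) := by
        refine h.isBigO.trans_tendsto ?_
        have : Tendsto (fun t : ℝ => t ^ (n + 1)) (𝓝 0) (𝓝 (0 ^ (n + 1))) :=
          (continuous_pow _).tendsto 0
        rw [zero_pow (by omega)] at this
        exact this.mono_left nhdsWithin_le_nhds
      have h2 : Tendsto (fun t : ℝ => ∑ k ∈ Finset.range (n + 1 + 1), t ^ k • c k) (𝓝 0)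
          (𝓝 (∑ k ∈ Finset.range (n + 1 + 1), (0 : ℝ) ^ k • c k)) :=
        Continuous.tendsto (by fun_prop) 0
      rw [Finset.sum_range_succ'] at h2
      simp only [zero_pow (Nat.succ_ne_zero _), zero_smul, Finset.sum_const_zero, pow_zero,
        one_smul, zero_add] at h2
      exact tendsto_nhds_unique (h2.mono_left nhdsWithin_le_nhds) h1
    have hs : ∀ k ≤ n, c (k + 1) = 0 := by
      refine ih (c := fun k => c (k + 1)) ?_
      rw [Asymptotics.isLittleO_iff] at h ⊢
      intro ε hε
      filter_upwards [h hε, self_mem_nhdsWithin] with t ht (ht0 : 0 < t)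
      rw [Finset.sum_range_succ', h0, smul_zero, add_zero] at ht
      simp only [pow_succ', mul_smul, ← Finset.smul_sum, norm_smul, norm_mul] at ht
      rw [mul_left_comm] at ht
      exact le_of_mul_le_mul_left ht (norm_pos_iff.2 ht0.ne')
    intro k hk
    cases k with
    | zero => exact h0
    | succ k => exact hs k (by omega)

theorem sum_range_two_mul_ite_even {M : Type*} [AddCommMonoid M] (a : ℕ → M) (n : ℕ) :
    ∑ j ∈ Finset.range (2 * n + 1), (if Even j then a (j / 2) else 0) =
      ∑ k ∈ Finset.range (n + 1), a k := by
  induction n with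
  | zero => simp
  | succ n ih =>
    rw [show 2 * (n + 1) + 1 = 2 * n + 1 + 1 + 1 by ring, Finset.sum_range_succ,
      Finset.sum_range_succ, ih, Finset.sum_range_succ _ (n + 1), if_neg (by grind),
      if_pos (by grind), add_zero]
    congr 2
    omega

/-- The Taylor coefficients at `0` of an even function, in terms of the square of the variable. -/
theorem iteratedDerivWithin_eq_iteratedDeriv_two_mul {g H : ℝ → ℂ} {n : ℕ}
    (hg : ContDiffAt ℝ ∞ g 0) (hH : ContDiffOn ℝ n H (Ici 0))
    (hgH : ∀ t, 0 ≤ t → g t = H (t ^ 2)) :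
    iteratedDerivWithin n H (Ici 0) 0 =
      ((n.factorial : ℝ) / ((2 * n).factorial : ℝ)) • iteratedDeriv (2 * n) g 0 := by
  have hgn : ∀ m : ℕ, ContDiffAt ℝ m g 0 := fun m => hg.of_le (mod_cast le_top)
  obtain ⟨u, hu, hgu⟩ := (hgn (2 * n)).contDiffOn le_rfl
    fun h => absurd (WithTop.coe_injective h : ((2 * n : ℕ) : ℕ∞) = ⊤) (ENat.natCast_ne_top _)
  obtain ⟨δ, hδ, hδu⟩ := Metric.nhds_basis_closedBall.mem_iff.1
    (show u ∈ 𝓝 (0 : ℝ) by simpa using hu)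
  have hsub : Icc 0 δ ⊆ u := fun x hx => hδu (by
    rw [Metric.mem_closedBall, Real.dist_eq, sub_zero, abs_of_nonneg hx.1]
    exact hx.2)
  have h0 : (0 : ℝ) ∈ Icc 0 δ := ⟨le_rfl, hδ.le⟩
  have T1 := (taylor_isLittleO (convex_Icc 0 δ) h0 (hgu.mono hsub)).mono
    (nhdsWithin_le_of_mem (Icc_mem_nhdsGT hδ) : 𝓝[>] (0 : ℝ) ≤ 𝓝[Icc 0 δ] 0)
  have T2 := (taylor_isLittleO (convex_Ici 0) self_mem_Ici hH).comp_tendsto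
    (k := fun t : ℝ => t ^ 2) (l' := 𝓝[>] 0) (by
      refine tendsto_nhdsWithin_iff.2 ⟨?_, Eventually.of_forall fun t => sq_nonneg t⟩
      have : Tendsto (fun t : ℝ => t ^ 2) (𝓝 0) (𝓝 (0 ^ 2)) := (continuous_pow _).tendsto 0
      rw [zero_pow two_ne_zero] at this
      exact this.mono_left nhdsWithin_le_nhds)
  simp only [Function.comp_def, sub_zero, ← pow_mul] at T1 T2
  -- Both remainders are `o(t^{2n})`, the second because `H` is expanded to order `n` at `t²`. As `g
  -- t = H (t²)`, their difference is a polynomial in `t`, whose coefficients must vanish.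
  have T := T1.sub T2
  set a : ℕ → ℂ := fun k => ((k ! : ℝ)⁻¹) • iteratedDerivWithin k H (Ici 0) 0
  set b : ℕ → ℂ := fun k => ((k ! : ℝ)⁻¹) • iteratedDeriv k g 0
  have key := eq_zero_of_sum_pow_isLittleO (n := 2 * n)
    (c := fun j => (if Even j then a (j / 2) else 0) - b j) (by
      refine T.congr' ?_ EventuallyEq.rfl
      filter_upwards [self_mem_nhdsWithin] with t (ht : 0 < t)
      have e1 : ∑ j ∈ Finset.range (2 * n + 1), t ^ j • (if Even j then a (j / 2) else 0) =
          ∑ k ∈ Finset.range (n + 1), t ^ (2 * k) • a k := by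
        rw [← sum_range_two_mul_ite_even (fun k => t ^ (2 * k) • a k)]
        refine Finset.sum_congr rfl fun j _ => ?_
        split_ifs with hj
        · rw [Nat.two_mul_div_two_of_even hj]
        · rw [smul_zero]
      simp only [smul_sub, Finset.sum_sub_distrib]
      rw [e1, hgH t ht.le, taylor_within_apply, taylor_within_apply]
      have e2 : ∀ k, iteratedDerivWithin k g (Icc 0 δ) 0 = iteratedDeriv k g 0 := fun k =>
        iteratedDerivWithin_eq_iteratedDeriv (uniqueDiffOn_Icc hδ) (hgn k) h0
      simp only [e2, sub_zero, a, b, smul_smul, ← pow_mul, mul_comm (_ ^ _)]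
      ring) (2 * n) le_rfl
  have h2 : a n = b (2 * n) := by
    simpa [sub_eq_zero] using key
  simp only [a, b] at h2
  have hn : (n ! : ℝ) ≠ 0 := by exact_mod_cast n.factorial_ne_zero
  rw [div_eq_mul_inv, mul_smul, ← h2, smul_smul, mul_inv_cancel₀ hn, one_smul]

end

section

open Filter Topology

/-! ### Differentiation of parameter integrals of arbitrary order -/

/-- Fixing the innermost direction leaves a scalar function, so an induction on the order can stay
with complex-valued integrands. -/
theorem iteratedFDeriv_succ_apply_eq_fderiv_apply {E : Type*} [NormedAddCommGroup E]
    [NormedSpace ℝ E] {f : E → ℂ} {x : E} (hf : ContDiffAt ℝ ∞ f x)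
    (k : ℕ) (m : Fin (k + 1) → E) :
    iteratedFDeriv ℝ (k + 1) f x m =
      iteratedFDeriv ℝ k (fun y => fderiv ℝ f y (m (Fin.last k))) x (Fin.init m) := by
  have h : ContDiffAt ℝ k (fderiv ℝ f) x := hf.fderiv_right (by exact_mod_cast le_top)
  have := ContinuousLinearMap.iteratedFDeriv_comp_left
    (ContinuousLinearMap.apply ℝ ℂ (m (Fin.last k))) h (i := k) le_rfl
  rw [iteratedFDeriv_succ_apply_right]
  exact (DFunLike.congr_fun this (Fin.init m)).symm

section ParametricIntegral

variable {E V : Type*} [NormedAddCommGroup E] [NormedSpace ℝ E]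
  [NormedAddCommGroup V] [NormedSpace ℝ V]

theorem fderiv_partial {g : E → V → ℂ} {U : Set E} (hU : IsOpen U)
    (hg : ContDiffOn ℝ ∞ (fun z : E × V => g z.1 z.2) (U ×ˢ univ)) {y : E} (hy : y ∈ U) (v : V) :
    HasFDerivAt (fun y => g y v)
      ((fderiv ℝ (fun z : E × V => g z.1 z.2) (y, v)).comp (ContinuousLinearMap.inl ℝ E V)) y := by
  have h1 : HasFDerivAt (fun z : E × V => g z.1 z.2)
      (fderiv ℝ (fun z : E × V => g z.1 z.2) (y, v)) (y, v) :=
    ((hg.contDiffAt ((hU.prod isOpen_univ).mem_nhds ⟨hy, mem_univ _⟩)).differentiableAt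
      (by simp)).hasFDerivAt
  exact HasFDerivAt.comp y (f := fun y => (y, v)) h1 (hasFDerivAt_prodMk_left y v)

theorem contDiffOn_fderiv_partial {g : E → V → ℂ} {U : Set E} (hU : IsOpen U)
    (hg : ContDiffOn ℝ ∞ (fun z : E × V => g z.1 z.2) (U ×ˢ univ)) (w : E) :
    ContDiffOn ℝ ∞ (fun z : E × V => fderiv ℝ (fun y => g y z.2) z.1 w) (U ×ˢ univ) := by
  have h := (hg.fderiv_of_isOpen (m := ∞) (hU.prod isOpen_univ) (by simp)).clm_apply
    (contDiffOn_const (c := (w, (0 : V))))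
  refine h.congr fun z hz => ?_
  rw [(fderiv_partial hU hg hz.1 z.2).fderiv]
  simp

theorem fderiv_partial_eq_zero {V : Type*} {g : E → V → ℂ} {U : Set E} (hU : IsOpen U) {K : Set V}
    (h0 : ∀ y ∈ U, ∀ v ∉ K, g y v = 0) {y : E} (hy : y ∈ U) {v : V} (hv : v ∉ K) :
    fderiv ℝ (fun y => g y v) y = 0 := by
  have : (fun y => g y v) =ᶠ[𝓝 y] fun _ => 0 :=
    eventually_of_mem (hU.mem_nhds hy) fun y' hy' => h0 y' hy' v hv
  rw [this.fderiv_eq]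
  simp

theorem integrable_of_contDiffOn_prod [MeasurableSpace V] [BorelSpace V] {μ : Measure V}
    [IsFiniteMeasureOnCompacts μ] {g : E → V → ℂ} {U : Set E} {K : Set V} (hK : IsCompact K)
    (hg : ContDiffOn ℝ ∞ (fun z : E × V => g z.1 z.2) (U ×ˢ univ))
    (h0 : ∀ y ∈ U, ∀ v ∉ K, g y v = 0) {y : E} (hy : y ∈ U) : Integrable (g y) μ := by
  have hc : Continuous (g y) :=
    hg.continuousOn.comp_continuous (Continuous.prodMk_right y) fun v => ⟨hy, mem_univ _⟩
  exact hc.integrable_of_hasCompactSupport (HasCompactSupport.intro hK fun v hv => h0 y hy v hv)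

/-- The partial derivative is continuous, hence bounded by some `C` on a closed ball times `K`, and
vanishes off `K`; so `C` times the indicator of `K` dominates it. -/
theorem hasFDerivAt_integral_of_contDiffOn_prod [MeasurableSpace V] [BorelSpace V] {μ : Measure V}
    [IsFiniteMeasureOnCompacts μ] [FiniteDimensional ℝ E] {g : E → V → ℂ} {U : Set E}
    (hU : IsOpen U) {K : Set V} (hK : IsCompact K)
    (hg : ContDiffOn ℝ ∞ (fun z : E × V => g z.1 z.2) (U ×ˢ univ))
    (h0 : ∀ y ∈ U, ∀ v ∉ K, g y v = 0) {y : E} (hy : y ∈ U) :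
    Integrable (fun v => fderiv ℝ (fun y => g y v) y) μ ∧
      HasFDerivAt (fun y => ∫ v, g y v ∂μ) (∫ v, fderiv ℝ (fun y => g y v) y ∂μ) y := by
  have hcont : ContinuousOn (fun z : E × V => fderiv ℝ (fun y => g y z.2) z.1) (U ×ˢ univ) := by
    have h1 : ContinuousOn (fun z : E × V => (fderiv ℝ (fun z : E × V => g z.1 z.2) z).comp
        (ContinuousLinearMap.inl ℝ E V)) (U ×ˢ univ) :=
      (hg.continuousOn_fderiv_of_isOpen (hU.prod isOpen_univ) (by simp)).clm_comp
        continuousOn_const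
    exact h1.congr fun z hz => (fderiv_partial hU hg hz.1 z.2).fderiv
  obtain ⟨δ, hδ, hδU⟩ := Metric.nhds_basis_closedBall.mem_iff.1 (hU.mem_nhds hy)
  have hcpt : IsCompact (Metric.closedBall y δ ×ˢ K) :=
    (isCompact_closedBall y δ).prod hK
  obtain ⟨C, hC⟩ := hcpt.exists_bound_of_continuousOn
    (hcont.mono (prod_mono hδU (subset_univ K)))
  have hc : Continuous (fun v => fderiv ℝ (fun y => g y v) y) :=
    hcont.comp_continuous (Continuous.prodMk_right y) fun v => ⟨hy, mem_univ _⟩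
  have hint : Integrable (fun v => fderiv ℝ (fun y => g y v) y) μ :=
    hc.integrable_of_hasCompactSupport
      (HasCompactSupport.intro hK fun v hv => fderiv_partial_eq_zero hU h0 hy hv)
  refine ⟨hint, hasFDerivAt_integral_of_dominated_of_fderiv_le
    (F' := fun y v => fderiv ℝ (fun y => g y v) y) (bound := K.indicator fun _ => C)
    (s := Metric.closedBall y δ)
    (Metric.closedBall_mem_nhds y hδ) ?_ (integrable_of_contDiffOn_prod hK hg h0 hy)
    hint.aestronglyMeasurable (Eventually.of_forall fun v x hx => ?_) ?_
    (Eventually.of_forall fun v x hx => ?_)⟩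
  · filter_upwards [hU.mem_nhds hy] with x hx
    exact (integrable_of_contDiffOn_prod hK hg h0 hx).aestronglyMeasurable
  · by_cases hv : v ∈ K
    · rw [indicator_of_mem hv]
      exact hC (x, v) ⟨hx, hv⟩
    · rw [indicator_of_notMem hv, fderiv_partial_eq_zero hU h0 (hδU hx) hv, norm_zero]
  · exact (integrable_indicator_iff hK.measurableSet).2
      (integrableOn_const hK.measure_lt_top.ne)
  · exact (fderiv_partial hU hg (hδU hx) v).differentiableAt.hasFDerivAt

variable [FiniteDimensional ℝ V] [MeasurableSpace V] [BorelSpace V] {μ : Measure V}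
  [μ.IsAddHaarMeasure]

theorem contDiffOn_integral_of_contDiffOn_prod {U : Set E} (hU : IsOpen U)
    {K : Set V} (hK : IsCompact K) {g : E → V → ℂ}
    (hg : ContDiffOn ℝ ∞ (fun z : E × V => g z.1 z.2) (U ×ˢ univ))
    (h0 : ∀ y ∈ U, ∀ v ∉ K, g y v = 0) : ContDiffOn ℝ ∞ (fun y => ∫ v, g y v ∂μ) U := by
  -- The integral is the convolution of `g y` with the constant 1, evaluated at 0, up to the
  -- reflection `v ↦ -v`.
  have h := contDiffOn_convolution_right_with_param (n := ⊤) (μ := μ) (f := fun _ : V => (1 : ℝ))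
    (ContinuousLinearMap.lsmul ℝ ℝ) hU hK (fun y v hy hv => h0 y hy v hv)
    (locallyIntegrable_const 1) hg
  refine (h.comp (contDiffOn_id.prodMk (contDiffOn_const (c := (0 : V))))
    fun y hy => ⟨hy, mem_univ _⟩).congr fun y hy => ?_
  simp only [Function.comp_apply, id, MeasureTheory.convolution_def, 
    ContinuousLinearMap.lsmul_apply, one_smul, zero_sub]
  exact (integral_neg_eq_self (g y) μ).symm

theorem iteratedFDeriv_integral_of_contDiffOn_prod [FiniteDimensional ℝ E] {U : Set E}
    (hU : IsOpen U) {K : Set V} (hK : IsCompact K) (k : ℕ) {g : E → V → ℂ}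
    (hg : ContDiffOn ℝ ∞ (fun z : E × V => g z.1 z.2) (U ×ˢ univ))
    (h0 : ∀ y ∈ U, ∀ v ∉ K, g y v = 0)
    {y : E} (hy : y ∈ U) (m : Fin k → E) :
    Integrable (fun v => iteratedFDeriv ℝ k (fun y => g y v) y m) μ ∧
      iteratedFDeriv ℝ k (fun y => ∫ v, g y v ∂μ) y m =
        ∫ v, iteratedFDeriv ℝ k (fun y => g y v) y m ∂μ := by
  induction k generalizing g with
  | zero =>
    simp only [iteratedFDeriv_zero_apply]
    exact ⟨integrable_of_contDiffOn_prod hK hg h0 hy, trivial⟩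
  | succ k ih =>
    have ih' := ih (g := fun y v => fderiv ℝ (fun y => g y v) y (m (Fin.last k)))
      (contDiffOn_fderiv_partial hU hg _)
      (fun y hy v hv => by rw [fderiv_partial_eq_zero hU h0 hy hv]; rfl) (Fin.init m)
    have hgv : ∀ v, ContDiffAt ℝ ∞ (fun y => g y v) y := fun v =>
      (hg.contDiffAt ((hU.prod isOpen_univ).mem_nhds ⟨hy, mem_univ v⟩)).comp y
        (contDiffAt_id.prodMk contDiffAt_const)
    simp only [fun v => iteratedFDeriv_succ_apply_eq_fderiv_apply (hgv v) k m]
    refine ⟨ih'.1, ?_⟩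
    rw [← ih'.2, iteratedFDeriv_succ_apply_eq_fderiv_apply
      ((contDiffOn_integral_of_contDiffOn_prod hU hK hg h0).contDiffAt (hU.mem_nhds hy))]
    have : (fun y => fderiv ℝ (fun y => ∫ v, g y v ∂μ) y (m (Fin.last k))) =ᶠ[𝓝 y]
        fun y => ∫ v, fderiv ℝ (fun y => g y v) y (m (Fin.last k)) ∂μ := by
      filter_upwards [hU.mem_nhds hy] with x hx
      obtain ⟨h1, h2⟩ := hasFDerivAt_integral_of_contDiffOn_prod (μ := μ) hU hK hg h0 hx
      rw [h2.fderiv, ContinuousLinearMap.integral_apply h1]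
    exact DFunLike.congr_fun (this.iteratedFDeriv (𝕜 := ℝ) k).eq_of_nhds _

end ParametricIntegral

/-! ### Pullbacks and fibre integrals -/

namespace Grass

variable {n m' n' : ℕ}

theorem coef_pull (u : Fin m' → Grass n) (w : Fin n' → Grass n) (F : (Fin m' → ℝ) → Grass n')
    (K : Finset (Fin n)) :
    coef K (pull u w F) = ∑ J : Finset (Fin n'), ∑ k ∈ Finset.range (n + 1), ∑ a : Fin k → Fin m',
      iteratedFDeriv ℝ k (fun y => coef J (F y)) (fun c => (coef ∅ (u c)).re)
        (fun l => Pi.single (a l) (1 : ℝ)) * coef K ((k ! : ℂ)⁻¹ •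
          (List.ofFn fun l => nil (u (a l))).prod * ((J.sort (· ≤ ·)).map w).prod) := by
  simp only [pull, coef_sum, Finset.sum_mul, Finset.smul_sum, smul_smul, smul_mul_assoc,
    coef_smul]
  refine Finset.sum_congr rfl fun J _ => Finset.sum_congr rfl fun k _ =>
    Finset.sum_congr rfl fun a _ => ?_
  ring

theorem pull_const_smul (c : ℂ) {u : Fin m' → Grass n} (w : Fin n' → Grass n)
    {F : (Fin m' → ℝ) → Grass n'}
    (hF : ∀ J, ContDiffAt ℝ ∞ (fun y => coef J (F y)) (fun c => (coef ∅ (u c)).re)) :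
    pull u w (fun y => c • F y) = c • pull u w F := by
  refine ext_coef fun K => ?_
  simp only [coef_smul, coef_pull, Finset.mul_sum]
  refine Finset.sum_congr rfl fun J _ => Finset.sum_congr rfl fun k _ =>
    Finset.sum_congr rfl fun a _ => ?_
  have := iteratedFDeriv_const_smul_apply' (a := c) ((hF J).of_le (mod_cast le_top : (k : ℕ∞ω) ≤ ∞))
  simp only [smul_eq_mul] at this
  rw [this, smul_apply, smul_eq_mul, mul_assoc]

/-- By `coef_pull`, a pullback is a finite combination of derivatives in the parameter with
coefficients independent of `v`, and each derivative passes under the integral. This makes the local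
fibre integrals glue over `S`. -/
theorem pull_integral {p : ℕ} {u : Fin m' → Grass n} (w : Fin n' → Grass n)
    {F : (Fin m' → ℝ) → (Fin p → ℝ) → Grass n'} {U : Set (Fin m' → ℝ)} (hU : IsOpen U)
    {K : Set (Fin p → ℝ)} (hK : IsCompact K)
    (hF : ∀ J, ContDiffOn ℝ ∞ (fun z : (Fin m' → ℝ) × (Fin p → ℝ) => coef J (F z.1 z.2))
      (U ×ˢ univ))
    (h0 : ∀ y ∈ U, ∀ v ∉ K, F y v = 0) (hu : (fun c => (coef ∅ (u c)).re) ∈ U)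
    (L : Finset (Fin n)) :
    coef L (pull u w fun y => ∑ J, (∫ v, coef J (F y v)) • basis n' J) =
      ∫ v, coef L (pull u w fun y => F y v) := by
  have h0' : ∀ J, ∀ y ∈ U, ∀ v ∉ K, coef J (F y v) = 0 := fun J y hy v hv => by
    rw [h0 y hy v hv]
    simp [coef]
  have key := fun (J : Finset (Fin n')) (k : ℕ) (m : Fin k → Fin m' → ℝ) =>
    iteratedFDeriv_integral_of_contDiffOn_prod (μ := volume) hU hK k (hF J) (h0' J) hu m
  simp only [coef_pull, coef_sum_smul_basis]
  rw [integral_finsetSum _ fun J _ => integrable_finsetSum _ fun k _ =>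
    integrable_finsetSum _ fun a _ => (key J k _).1.mul_const _]
  refine Finset.sum_congr rfl fun J _ => ?_
  rw [integral_finsetSum _ fun k _ =>
    integrable_finsetSum _ fun a _ => (key J k _).1.mul_const _]
  refine Finset.sum_congr rfl fun k _ => ?_
  rw [integral_finsetSum _ fun a _ => (key J k _).1.mul_const _]
  refine Finset.sum_congr rfl fun a _ => ?_
  rw [integral_mul_const, (key J k _).2]

end Grass

/-! ### Fibre integrals of superfunctions with locally bounded fibre supports -/

namespace CSManifold

variable {S : CSManifold.{u, v}}

theorem even_body_re {i j : S.Idx} {s : Fin (S.m i) → ℝ}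
    (hs : s ∈ ((S.chart i).symm.trans (S.chart j)).source) :
    (fun c => (Grass.coef ∅ (S.even i j s c)).re) = S.chart j ((S.chart i).symm s) := by
  funext c
  rw [S.even_body i j s hs c, Complex.ofReal_re]

theorem transition_mem_target {i j : S.Idx} {s : Fin (S.m i) → ℝ}
    (hs : s ∈ ((S.chart i).symm.trans (S.chart j)).source) :
    (fun c => (Grass.coef ∅ (S.even i j s c)).re) ∈ (S.chart j).target := by
  rw [even_body_re hs]
  refine (S.chart j).map_source ?_
  simpa using (mem_inter_iff _ _ _).1 hs |>.2

theorem Superfun.contDiffAt_left {E : Type*} [NormedAddCommGroup E] [NormedSpace ℝ E]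
    (F : S.Superfun (univ : Set E)) (i : S.Idx) (J : Finset (Fin (S.n i))) (x : E)
    {s : Fin (S.m i) → ℝ} (hs : s ∈ (S.chart i).target) :
    ContDiffAt ℝ ∞ (fun s => Grass.coef J (F.toFun i s x)) s :=
  ContDiffAt.comp s (g := fun z : (Fin (S.m i) → ℝ) × E => Grass.coef J (F.toFun i z.1 z.2))
    (f := fun s => (s, x)) ((F.smooth i J).contDiffAt
      (((S.chart i).open_target.prod isOpen_univ).mem_nhds ⟨hs, mem_univ x⟩))
    (contDiffAt_id.prodMk contDiffAt_const)

theorem Superfun.contDiff_right {E : Type*} [NormedAddCommGroup E] [NormedSpace ℝ E]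
    (F : S.Superfun (univ : Set E)) (i : S.Idx) (J : Finset (Fin (S.n i)))
    {s : Fin (S.m i) → ℝ} (hs : s ∈ (S.chart i).target) :
    ContDiff ℝ ∞ (fun x => Grass.coef J (F.toFun i s x)) :=
  contDiffOn_univ.1 (ContDiffOn.comp (t := (S.chart i).target ×ˢ univ)
    (g := fun z : (Fin (S.m i) → ℝ) × E => Grass.coef J (F.toFun i z.1 z.2))
    (f := fun x => (s, x)) (F.smooth i J) (contDiffOn_const.prodMk contDiffOn_id)
    fun _ _ => ⟨hs, mem_univ _⟩)

/-- A scalar multiple of the pullback of a superfunction along a linear map of the fibres. -/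
noncomputable def Superfun.smulComp {E E' : Type*} [NormedAddCommGroup E] [NormedSpace ℝ E]
    [NormedAddCommGroup E'] [NormedSpace ℝ E'] (F : S.Superfun (univ : Set E)) (c : ℂ)
    (L : E' →L[ℝ] E) : S.Superfun (univ : Set E') where
  toFun i s x := c • F.toFun i s (L x)
  smooth i J := by
    simp only [Grass.coef_smul]
    refine contDiffOn_const.mul ((F.smooth i J).comp (t := (S.chart i).target ×ˢ univ)
      (f := fun z : (Fin (S.m i) → ℝ) × E' => (z.1, L z.2))
      (ContDiff.contDiffOn (by fun_prop)) fun z hz => ⟨hz.1, mem_univ _⟩)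
  compat i j s hs x _ := by
    rw [F.compat i j s hs (L x) (mem_univ _)]
    exact (Grass.pull_const_smul c _ fun J =>
      F.contDiffAt_left j J (L x) (transition_mem_target hs)).symm

/-- The supports in the fibres are bounded, locally uniformly in `S₀`. -/
def FibreFun.LocallyBounded {p N : ℕ} (f : S.FibreFun p N) : Prop :=
  ∀ x : S.Pt, ∃ U ∈ 𝓝 x, ∃ R : ℝ, ∀ y ∈ U, ∀ i, y ∈ (S.chart i).source → ∀ I v, R < ‖v‖ →
    (f I).toFun i (S.chart i y) v = 0

/-- The support over `x` is compact, so it lies in an open ball of radius `R`. The part of the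
support outside this ball has closed image in `S₀`, which misses `x`; its complement is the required
neighbourhood. -/
theorem FibreFun.FibreCompact.locallyBounded {p N : ℕ} {f : S.FibreFun p N}
    (hf : f.FibreCompact) : f.LocallyBounded := by
  intro x
  have hK : IsCompact ((fun z : f.support => z.1.2) ''
      ((fun z : f.support => z.1.1) ⁻¹' {x})) :=
    (hf.isCompact_preimage isCompact_singleton).image (by fun_prop)
  obtain ⟨R, hR⟩ := hK.isBounded.subset_ball 0
  have hC : IsClosed ((fun z : f.support => z.1.1) '' {z | R ≤ ‖z.1.2‖}) :=
    hf.isClosedMap _ (isClosed_le continuous_const (by fun_prop))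
  refine ⟨_, hC.isOpen_compl.mem_nhds ?_, R, fun y hy i hi I v hv => ?_⟩
  · rintro ⟨z, hz, rfl⟩
    have := hR ⟨z, rfl, rfl⟩
    rw [mem_ball_zero_iff] at this
    exact not_le.2 this hz
  · by_contra h
    exact hy ⟨⟨(y, v), subset_closure ⟨i, hi, I, h⟩⟩, hv.le, rfl⟩

/-- An ultrafilter on the support whose projection converges has its fibre component eventually in a
compact ball, hence convergent; the limit lies in the support because that is closed. -/
theorem FibreFun.LocallyBounded.fibreCompact {p N : ℕ} {f : S.FibreFun p N}
    (hf : f.LocallyBounded) : f.FibreCompact := by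
  rw [FibreFun.FibreCompact, isProperMap_iff_ultrafilter]
  refine ⟨by fun_prop, fun 𝒰 x hx => ?_⟩
  obtain ⟨U, hU, R, hR⟩ := hf x
  have hbd : ∀ z : f.support, z.1.1 ∈ interior U → z.1.2 ∈ Metric.closedBall 0 R := by
    rintro ⟨z, hz⟩ hzU
    by_contra hzR
    have hopen : IsOpen (interior U ×ˢ (Metric.closedBall (0 : Fin p → ℝ) R)ᶜ) :=
      isOpen_interior.prod Metric.isClosed_closedBall.isOpen_compl
    obtain ⟨z', ⟨h1, h2⟩, i, hi, I, hI⟩ := mem_closure_iff.1 hz _ hopen ⟨hzU, hzR⟩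
    exact hI (hR _ (interior_subset h1) i hi I _ (by simpa using h2))
  have hev : ∀ᶠ z in (𝒰 : Filter f.support), z.1.2 ∈ Metric.closedBall 0 R :=
    (hx.eventually (interior_mem_nhds.2 hU |> fun h => mem_of_superset h fun _ h => h)).mono
      fun z hz => hbd z hz
  obtain ⟨v, _, hv⟩ := (isCompact_closedBall (0 : Fin p → ℝ) R).ultrafilter_le_nhds
    (𝒰.map fun z : f.support => z.1.2) (le_principal_iff.2 hev)
  have hlim : Tendsto (fun z : f.support => z.1) 𝒰 (𝓝 (x, v)) := hx.prodMk_nhds hv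
  have hmem : (x, v) ∈ f.support :=
    isClosed_closure.mem_of_tendsto hlim (Eventually.of_forall fun z => z.2)
  refine ⟨⟨(x, v), hmem⟩, rfl, ?_⟩
  rw [nhds_subtype_eq_comap]
  exact tendsto_iff_comap.1 hlim

theorem FibreFun.LocallyBounded.exists_chart {p N : ℕ} {f : S.FibreFun p N}
    (hf : f.LocallyBounded) (i : S.Idx) {s : Fin (S.m i) → ℝ} (hs : s ∈ (S.chart i).target) :
    ∃ U : Set (Fin (S.m i) → ℝ), IsOpen U ∧ s ∈ U ∧ U ⊆ (S.chart i).target ∧ ∃ R : ℝ,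
      ∀ y ∈ U, ∀ I v, v ∉ Metric.closedBall 0 R → (f I).toFun i y v = 0 := by
  obtain ⟨W, hW, R, hR⟩ := hf ((S.chart i).symm s)
  refine ⟨_, (S.chart i).isOpen_inter_preimage_symm (isOpen_interior (s := W)),
    ⟨hs, mem_interior_iff_mem_nhds.2 hW⟩, inter_subset_left, R, fun y hy I v hv => ?_⟩
  have := hR _ (interior_subset hy.2) i ((S.chart i).map_target hy.1) I v (by simpa using hv)
  rwa [(S.chart i).right_inv hy.1] at this

theorem FibreFun.LocallyBounded.fibreIntegrable {p q : ℕ} {f : S.FibreFun p (2 * q)}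
    (hf : f.LocallyBounded) (i : S.Idx) {s : Fin (S.m i) → ℝ} (hs : s ∈ (S.chart i).target)
    (J : Finset (Fin (S.n i))) : FibreIntegrable f i s J := by
  obtain ⟨U, _, hsU, _, R, hR⟩ := hf.exists_chart i hs
  refine (((f Finset.univ).contDiff_right i J hs).continuous).integrable_of_hasCompactSupport
    (HasCompactSupport.intro (isCompact_closedBall 0 R) fun v hv => ?_)
  rw [hR s hsU _ v hv]
  simp [Grass.coef]

/-- The fibre integral, as a superfunction on `S`. -/
noncomputable def FibreFun.LocallyBounded.integral {p q : ℕ} {f : S.FibreFun p (2 * q)}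
    (hf : f.LocallyBounded) : S.BaseFun where
  toFun i s _ := ((((-2 * Real.pi) ^ q)⁻¹ : ℝ) : ℂ) •
    ∑ J, (∫ v : Fin p → ℝ, Grass.coef J ((f Finset.univ).toFun i s v)) • Grass.basis _ J
  smooth i J := by
    simp only [Grass.coef_smul, Grass.coef_sum_smul_basis]
    refine contDiffOn_const.mul fun z hz => ContDiffAt.contDiffWithinAt ?_
    obtain ⟨U, hU, hsU, hUt, R, hR⟩ := hf.exists_chart i hz.1
    refine ContDiffAt.comp z (g := fun s => ∫ v : Fin p → ℝ,
      Grass.coef J ((f Finset.univ).toFun i s v)) (f := Prod.fst)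
      ((contDiffOn_integral_of_contDiffOn_prod hU
      (isCompact_closedBall 0 R) (((f Finset.univ).smooth i J).mono (prod_mono hUt le_rfl))
      fun y hy v hv => ?_).contDiffAt (hU.mem_nhds hsU)) contDiffAt_fst
    rw [hR y hy _ v hv]
    simp [Grass.coef]
  compat i j s hs x _ := by
    have ht := transition_mem_target hs
    obtain ⟨U, hU, hsU, hUt, R, hR⟩ := hf.exists_chart j ht
    have hK := isCompact_closedBall (0 : Fin p → ℝ) R
    have hF := fun J => ((f Finset.univ).smooth j J).mono (prod_mono hUt (le_refl univ))
    rw [Grass.pull_const_smul]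
    · congr 1
      refine Grass.ext_coef fun K => ?_
      rw [Grass.coef_sum_smul_basis, Grass.pull_integral _ hU hK hF (fun y hy => hR y hy _) hsU]
      refine integral_congr_ae (Eventually.of_forall fun v => ?_)
      simp only
      rw [(f Finset.univ).compat i j s hs v (mem_univ _)]
    · intro J
      simp only [Grass.coef_sum_smul_basis]
      refine (contDiffOn_integral_of_contDiffOn_prod hU hK (hF J) fun y hy v hv => ?_).contDiffAt
        (hU.mem_nhds hsU)
      rw [hR y hy _ v hv]
      simp [Grass.coef]

theorem FibreFun.LocallyBounded.hasFibreIntegral {p q : ℕ} {f : S.FibreFun p (2 * q)}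
    (hf : f.LocallyBounded) : HasFibreIntegral f hf.integral := by
  refine fun i s hs J => ⟨hf.fibreIntegrable i hs J, ?_⟩
  simp only [FibreFun.LocallyBounded.integral, Grass.coef_smul, Grass.coef_sum_smul_basis]
  rw [fibreIntegral, Complex.real_smul]

end CSManifold

end

/-! ### Radial superfunctions and their profiles -/

section

open Filter Topology

namespace Grass

theorem coef_taylorNormSq_eq_sum {q : ℕ} (d : ℕ → ℂ) (I : Finset (Fin (2 * q))) :
    coef I (CSManifold.taylorNormSq q d) =
      ∑ k ∈ Finset.range (q + 1), d k / (k ! : ℂ) * coef I (CSManifold.oddNormSq q ^ k) := by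
  simp only [CSManifold.taylorNormSq, coef_sum, coef_smul]

end Grass

namespace CSManifold

variable {S : CSManifold.{u, v}} {p q p' q' : ℕ}

variable (S) in
/-- A family of local radial functions with values in the functions on the charts of `S`. -/
abbrev Profile := ∀ i, (Fin (S.m i) → ℝ) → ℝ → Grass (S.n i)

/-- The coefficient of `θ^J` in `r ↦ fo(s, √r)`. -/
noncomputable abbrev Profile.sqrtCoef (fo : S.Profile) (i : S.Idx) (s : Fin (S.m i) → ℝ)
    (J : Finset (Fin (S.n i))) (r : ℝ) : ℂ :=
  Grass.coef J (fo i s (√r))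

/-- `r ↦ fo(s, √r)` is continuous at `0` and smooth on `(0, ∞)`. -/
def Profile.Regular (fo : S.Profile) : Prop :=
  ∀ i, ∀ s ∈ (S.chart i).target, ∀ J, ContDiffOn ℝ ∞ (fo.sqrtCoef i s J) (Ioi 0) ∧
    ContinuousWithinAt (fo.sqrtCoef i s J) (Ici 0) 0

theorem contDiffOn_sqrtCoef_of_comp_sq {fo : S.Profile} (G : S.Superfun (univ : Set ℝ))
    {i : S.Idx} {s : Fin (S.m i) → ℝ} (hs : s ∈ (S.chart i).target)
    (hG : ∀ t : ℝ, fo i s t = G.toFun i s (t ^ 2)) (J : Finset (Fin (S.n i))) :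
    EqOn (fo.sqrtCoef i s J) (fun r => Grass.coef J (G.toFun i s r)) (Ici 0) ∧
      ContDiffOn ℝ ∞ (fo.sqrtCoef i s J) (Ici 0) := by
  have h : EqOn (fo.sqrtCoef i s J) (fun r => Grass.coef J (G.toFun i s r)) (Ici 0) := by
    intro r hr
    simp only [Profile.sqrtCoef]
    rw [hG, Real.sq_sqrt hr]
  exact ⟨h, (G.contDiff_right i J hs).contDiffOn.congr h⟩

theorem Superfun.contDiffOn_right {E : Type*} [NormedAddCommGroup E] [NormedSpace ℝ E] {V : Set E}
    (F : S.Superfun V) (i : S.Idx) (J : Finset (Fin (S.n i)))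
    {s : Fin (S.m i) → ℝ} (hs : s ∈ (S.chart i).target) :
    ContDiffOn ℝ ∞ (fun x => Grass.coef J (F.toFun i s x)) V :=
  ContDiffOn.comp (t := (S.chart i).target ×ˢ V)
    (g := fun z : (Fin (S.m i) → ℝ) × E => Grass.coef J (F.toFun i z.1 z.2))
    (f := fun x => (s, x)) (F.smooth i J) (contDiffOn_const.prodMk contDiffOn_id)
    fun _ hx => ⟨hs, hx⟩

theorem FibreFun.HasProfile.regular {f : S.FibreFun p (2 * q)} {fo : S.Profile}
    (hf : f.HasProfile fo) : fo.Regular := by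
  intro i s hs J
  rcases hf with ⟨_, ε, hε, F, rfl, _⟩ | ⟨_, G, _, hG⟩
  · have hF := F.contDiffOn_right i J hs
    have hm : ∀ r : ℝ, √r ∈ Ioi (-ε) := fun r => (neg_neg_of_pos hε).trans_le (Real.sqrt_nonneg r)
    refine ⟨ContDiffOn.comp hF (fun r hr => ?_) fun r _ => hm r, ?_⟩
    · exact (Real.contDiffAt_sqrt (ne_of_gt hr)).contDiffWithinAt
    · exact (hF.continuousOn.comp_continuous Real.continuous_sqrt hm).continuousWithinAt
  · have h := (contDiffOn_sqrtCoef_of_comp_sq G hs (hG i s hs) J).2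
    exact ⟨h.mono Ioi_subset_Ici_self, h.continuousOn 0 self_mem_Ici⟩

theorem sum_single_sqrt_sq (hp : 0 < p) {r : ℝ} (hr : 0 ≤ r) :
    ∑ c, (Pi.single (M := fun _ : Fin p => ℝ) ⟨0, hp⟩ (√r)) c ^ 2 = r := by
  rw [Finset.sum_eq_single_of_mem ⟨0, hp⟩ (Finset.mem_univ _)]
  · simp [Real.sq_sqrt hr]
  · intro c _ hc
    simp [hc]

theorem sum_sq_pos {v : Fin p → ℝ} (hv : v ≠ 0) : 0 < ∑ c, v c ^ 2 := by
  obtain ⟨c, hc⟩ := Function.ne_iff.1 hv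
  exact Finset.sum_pos' (fun _ _ => sq_nonneg _) ⟨c, Finset.mem_univ _, by
    have : v c ≠ 0 := hc
    positivity⟩

/-- The norm on `Fin p → ℝ` is the supremum norm, whereas the profile is evaluated at the Euclidean
one. -/
theorem norm_sq_le_sum_sq (v : Fin p → ℝ) : ‖v‖ ^ 2 ≤ ∑ c, v c ^ 2 := by
  have h : ‖v‖ ≤ √(∑ c, v c ^ 2) :=
    (pi_norm_le_iff_of_nonneg (Real.sqrt_nonneg _)).2 fun c => by
      rw [Real.norm_eq_abs]
      exact Real.abs_le_sqrt (Finset.single_le_sum (f := fun c => v c ^ 2)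
        (fun _ _ => sq_nonneg _) (Finset.mem_univ c))
  calc ‖v‖ ^ 2 ≤ √(∑ c, v c ^ 2) ^ 2 := by gcongr
    _ = _ := Real.sq_sqrt (Finset.sum_nonneg fun _ _ => sq_nonneg _)

/-- A superfunction on `S × 𝔸^{p|2q}`, `p > 0`, that is given by the radial profile `fo` away from `0` is
so everywhere, and the smoothness of its coefficients at `0` makes `r ↦ fo(s, √r)` of class `C^q`. -/
theorem contDiffOn_sqrtCoef_of_radial (hp : 0 < p) {f : S.FibreFun p (2 * q)} {fo : S.Profile}
    (hfo : fo.Regular) {i : S.Idx} {s : Fin (S.m i) → ℝ} (hs : s ∈ (S.chart i).target)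
    {J : Finset (Fin (S.n i))}
    (hf : ∀ v : Fin p → ℝ, v ≠ 0 → FibreFun.oddCoef f i s v J =
      taylorNormSq q fun k => iteratedDeriv k (fo.sqrtCoef i s J) (∑ c, v c ^ 2)) :
    ContDiffOn ℝ q (fo.sqrtCoef i s J) (Ici 0) ∧ ∀ v : Fin p → ℝ, FibreFun.oddCoef f i s v J =
      taylorNormSq q fun k => iteratedDerivWithin k (fo.sqrtCoef i s J) (Ici 0) (∑ c, v c ^ 2) := by
  set H := fo.sqrtCoef i s J
  obtain ⟨hH, hH0⟩ := hfo i s hs J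
  -- A test curve with squared Euclidean length `r`, ending at the origin.
  set e : ℝ → Fin p → ℝ := fun r => Pi.single ⟨0, hp⟩ (√r)
  have he0 : e 0 = 0 := by simp [e]
  have hlim : ∀ I, Tendsto (fun r => Grass.coef J ((f I).toFun i s (e r))) (𝓝[>] 0)
      (𝓝 (Grass.coef J ((f I).toFun i s 0))) := by
    intro I
    have hc : Continuous fun r => Grass.coef J ((f I).toFun i s (e r)) :=
      ((f I).contDiff_right i J hs).continuous.comp
        ((continuous_single (A := fun _ : Fin p => ℝ) ⟨0, hp⟩).comp Real.continuous_sqrt)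
    have := hc.tendsto 0
    rw [he0] at this
    exact this.mono_left nhdsWithin_le_nhds
  have hval : ∀ I, ∀ r, 0 < r → Grass.coef J ((f I).toFun i s (e r)) =
      Grass.coef I (taylorNormSq q fun k => iteratedDeriv k H r) := by
    intro I r hr
    have hne : e r ≠ 0 := by
      intro h
      have := congrFun h ⟨0, hp⟩
      simp only [e, Pi.single_eq_same, Pi.zero_apply] at this
      exact (Real.sqrt_pos.2 hr).ne' this
    rw [← FibreFun.coef_oddCoef, hf _ hne]
    simp only [e, sum_single_sqrt_sq hp hr.le]
  -- The `ξ^I`-coefficient of `f` along `e`, with `I` in the support of the `k`-th power of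
  -- `oddNormSq q`, is a nonzero multiple of the `k`-th derivative of `H`, and it is continuous at
  -- 0.
  have hL : ∀ k ≤ q, ∃ L, Tendsto (iteratedDeriv k H) (𝓝[>] 0) (𝓝 L) := by
    intro k hk
    obtain ⟨I, hI⟩ := Grass.exists_coef_oddNormSq_pow_ne_zero hk
    have hcard : I.card = 2 * k := by
      by_contra h
      exact hI (Grass.coef_oddNormSq_pow_eq_zero h)
    refine ⟨_, ((hlim I).const_mul ((k ! : ℂ) / Grass.coef I (oddNormSq q ^ k))).congr' ?_⟩
    filter_upwards [self_mem_nhdsWithin] with r hr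
    rw [hval I r hr, Grass.coef_taylorNormSq hk _ hcard]
    have : (k ! : ℂ) ≠ 0 := by exact_mod_cast k.factorial_ne_zero
    field_simp
  choose! L hL using hL
  obtain ⟨h1, h2⟩ := contDiffOn_Ici_of_tendsto_iteratedDeriv hH hH0 hL
  refine ⟨h1, fun v => ?_⟩
  by_cases hv : v = 0
  · subst hv
    refine Grass.ext_coef fun I => ?_
    rw [FibreFun.coef_oddCoef]
    simp only [Pi.zero_apply, ne_eq, OfNat.ofNat_ne_zero, not_false_eq_true, zero_pow,
      Finset.sum_const_zero]
    -- At the origin both sides are limits along `e`.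
    refine tendsto_nhds_unique (hlim I) (Tendsto.congr'
      (f₁ := fun r => Grass.coef I (taylorNormSq q fun k => iteratedDeriv k H r)) ?_ ?_)
    · filter_upwards [self_mem_nhdsWithin] with r hr
      exact (hval I r hr).symm
    · simp only [Grass.coef_taylorNormSq_eq_sum]
      refine tendsto_finsetSum _ fun k hk => ?_
      have hk' : k ≤ q := by simpa [Nat.lt_succ_iff] using hk
      rw [h2 k hk']
      exact ((hL k hk').div_const _).mul_const _
  · rw [hf v hv]
    simp only [iteratedDerivWithin_Ici_eq hH _ (sum_sq_pos hv), H]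

theorem FibreFun.HasProfile.isRadial {f : S.FibreFun p (2 * q)} {fo : S.Profile}
    (hf : f.HasProfile fo) : f.IsRadial fo := by
  intro i s hs v J
  have hreg := hf.regular
  rcases hf with ⟨hp, ε, hε, F, rfl, hF⟩ | ⟨rfl, G, hfG, hG⟩
  · exact (contDiffOn_sqrtCoef_of_radial hp hreg hs fun v hv => hF i s hs v hv J).2 v
  · rw [hfG i s hs v J]
    have h := contDiffOn_sqrtCoef_of_comp_sq G hs (hG i s hs) J
    congr 1
    funext k
    rw [Finset.univ_eq_empty, Finset.sum_empty, iteratedDerivWithin_congr h.1 self_mem_Ici,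
      iteratedDerivWithin_eq_iteratedDeriv (uniqueDiffOn_Ici 0)
        ((G.contDiff_right i J hs).contDiffAt.of_le (mod_cast le_top)) self_mem_Ici]

theorem FibreFun.IsRadial.contDiffOn (hp : 0 < p) {f : S.FibreFun p (2 * q)} {fo : S.Profile}
    (hf : f.IsRadial fo) (hfo : fo.Regular) {i : S.Idx} {s : Fin (S.m i) → ℝ}
    (hs : s ∈ (S.chart i).target) (J : Finset (Fin (S.n i))) :
    ContDiffOn ℝ q (fo.sqrtCoef i s J) (Ici 0) := by
  refine (contDiffOn_sqrtCoef_of_radial hp (f := f) hfo hs fun v hv => ?_).1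
  rw [hf i s hs v J]
  simp only [iteratedDerivWithin_Ici_eq (hfo i s hs J).1 _ (sum_sq_pos hv)]

theorem FibreFun.HasProfile.contDiffOn {f : S.FibreFun p (2 * q)} {fo : S.Profile}
    (hf : f.HasProfile fo) {i : S.Idx} {s : Fin (S.m i) → ℝ}
    (hs : s ∈ (S.chart i).target) (J : Finset (Fin (S.n i))) :
    ContDiffOn ℝ q (fo.sqrtCoef i s J) (Ici 0) := by
  rcases p.eq_zero_or_pos with hp | hp
  · rcases hf with ⟨hp', _⟩ | ⟨_, G, _, hG⟩
    · omega
    · exact (contDiffOn_sqrtCoef_of_comp_sq G hs (hG i s hs) J).2.of_le (mod_cast le_top)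
  · exact hf.isRadial.contDiffOn hp hf.regular hs J

theorem FibreFun.IsRadial.coef_eq {f : S.FibreFun p (2 * q)} {fo : S.Profile}
    (hf : f.IsRadial fo) {i : S.Idx} {s : Fin (S.m i) → ℝ} (hs : s ∈ (S.chart i).target)
    (J : Finset (Fin (S.n i))) (I : Finset (Fin (2 * q))) (v : Fin p → ℝ) :
    Grass.coef J ((f I).toFun i s v) = Grass.coef I (taylorNormSq q fun k =>
      iteratedDerivWithin k (fo.sqrtCoef i s J) (Ici 0) (∑ c, v c ^ 2)) := by
  rw [← FibreFun.coef_oddCoef, hf i s hs v J]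

theorem FibreFun.IsRadial.coef_univ_eq {f : S.FibreFun p (2 * q)} {fo : S.Profile}
    (hf : f.IsRadial fo) {i : S.Idx} {s : Fin (S.m i) → ℝ} (hs : s ∈ (S.chart i).target)
    (J : Finset (Fin (S.n i))) (v : Fin p → ℝ) :
    Grass.coef J ((f Finset.univ).toFun i s v) = 2 ^ q *
      iteratedDerivWithin q (fo.sqrtCoef i s J) (Ici 0) (∑ c, v c ^ 2) := by
  rw [hf.coef_eq hs, Grass.coef_univ_taylorNormSq]

theorem FibreFun.IsRadial.fibreIntegrable_iff (hp : 0 < p) {f : S.FibreFun p (2 * q)}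
    {fo : S.Profile} (hf : f.IsRadial fo) {i : S.Idx} {s : Fin (S.m i) → ℝ}
    (hs : s ∈ (S.chart i).target) (J : Finset (Fin (S.n i))) :
    FibreIntegrable f i s J ↔ IntegrableOn (fun r : ℝ => r ^ ((p : ℝ) / 2 - 1) •
      iteratedDerivWithin q (fo.sqrtCoef i s J) (Ici 0) r) (Ioi 0) := by
  rw [FibreIntegrable, ← integrable_comp_sum_sq_iff hp]
  simp only [hf.coef_univ_eq hs]
  exact integrable_const_mul_iff (IsUnit.mk0 _ (by simp)) _

/-- No integrability is assumed: the polar formula is an identity of Bochner integrals, both sides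
being 0 when they diverge. -/
theorem FibreFun.IsRadial.fibreIntegral_eq {f : S.FibreFun p (2 * q)}
    {fo : S.Profile} (hf : f.IsRadial fo) {i : S.Idx} {s : Fin (S.m i) → ℝ}
    (hs : s ∈ (S.chart i).target) (J : Finset (Fin (S.n i))) :
    fibreIntegral f i s J = radialIntegral p q (fo.sqrtCoef i s J) := by
  have hc : ∀ z : ℂ, (((-2 * Real.pi) ^ q)⁻¹ : ℝ) • (2 ^ q * z) = (-Real.pi) ^ (-(q : ℤ)) • z := by
    intro z
    have h : (2 : ℂ) ^ q * z = ((2 : ℝ) ^ q) • z := by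
      rw [Complex.real_smul]
      push_cast
      rfl
    rw [h, smul_smul, zpow_neg, zpow_natCast]
    congr 1
    rw [show -2 * Real.pi = 2 * -Real.pi by ring, mul_pow]
    have := Real.pi_pos.ne'
    field_simp
  rw [fibreIntegral, radialIntegral]
  simp only [hf.coef_univ_eq hs]
  rw [integral_const_mul, hc]
  congr 1
  split_ifs with hp
  · subst hp
    -- Lebesgue measure on `ℝ⁰` is the point mass.
    rw [Measure.volume_pi_eq_dirac, integral_dirac, Finset.univ_eq_empty, Finset.sum_empty]
  · exact integral_comp_sum_sq (Nat.pos_of_ne_zero hp) _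

theorem fibreIntegrable_of_eq_zero (hp : p = 0) (f : S.FibreFun p (2 * q))
    (i : S.Idx) (s : Fin (S.m i) → ℝ) (J : Finset (Fin (S.n i))) : FibreIntegrable f i s J := by
  subst hp
  rw [FibreIntegrable, Measure.volume_pi_eq_dirac]
  exact integrable_dirac (by simp)

/-- A bound for the support of a radial superfunction on `S × 𝔸^{p|2q}`, `p > 0`, bounds the support
of the profile. -/
theorem FibreFun.IsRadial.sqrtCoef_eq_zero (hp : 0 < p) {f : S.FibreFun p (2 * q)} {fo : S.Profile}
    (hf : f.IsRadial fo) {i : S.Idx} {s : Fin (S.m i) → ℝ} (hs : s ∈ (S.chart i).target)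
    {R : ℝ} (hR : ∀ I v, R < ‖v‖ → (f I).toFun i s v = 0) (J : Finset (Fin (S.n i))) (r : ℝ)
    (hr : max R 0 ^ 2 < r) : fo.sqrtCoef i s J r = 0 := by
  -- The coefficient of exterior degree 0 is the undifferentiated profile.
  obtain ⟨I, hI⟩ := Grass.exists_coef_oddNormSq_pow_ne_zero (Nat.zero_le q)
  have hcard : I.card = 2 * 0 := by
    by_contra h
    exact hI (Grass.coef_oddNormSq_pow_eq_zero h)
  have hr0 : 0 ≤ r := (sq_nonneg _).trans hr.le
  have h := hf.coef_eq hs J I (Pi.single ⟨0, hp⟩ (√r))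
  rw [hR, sum_single_sqrt_sq hp hr0, Grass.coef_taylorNormSq (Nat.zero_le q) _ hcard] at h
  · simp only [iteratedDerivWithin_zero, Nat.factorial_zero, Nat.cast_one, div_one] at h
    exact (mul_eq_zero.1 (h.symm.trans (by simp [Grass.coef]))).resolve_right hI
  · rw [Pi.norm_single, Real.norm_of_nonneg (Real.sqrt_nonneg _)]
    exact (le_max_left R 0).trans_lt (Real.lt_sqrt_of_sq_lt hr)

theorem FibreFun.LocallyBounded.sqrtCoef_eq_zero (hp : 0 < p) {f : S.FibreFun p (2 * q)}
    {fo : S.Profile} (hb : f.LocallyBounded) (hf : f.IsRadial fo) {i : S.Idx}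
    {s : Fin (S.m i) → ℝ} (hs : s ∈ (S.chart i).target) (J : Finset (Fin (S.n i))) :
    ∃ B, ∀ r, B < r → fo.sqrtCoef i s J r = 0 := by
  obtain ⟨U, _, hsU, _, R, hR⟩ := hb.exists_chart i hs
  exact ⟨_, hf.sqrtCoef_eq_zero hp hs (fun I v hv => hR s hsU I v (by simpa using hv)) J⟩

/-- A support bound for `f` is one for the profile, hence for all its derivatives and for `f'`. If
`p' = 0` the fibres are points and nothing about the profile is needed. -/
theorem FibreFun.IsRadial.locallyBounded {f : S.FibreFun p (2 * q)} {f' : S.FibreFun p' (2 * q')}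
    {fo : S.Profile} (hf : f.IsRadial fo) (hf' : f'.IsRadial fo) (hp : 0 < p' → 0 < p)
    (hb : f.LocallyBounded) : f'.LocallyBounded := by
  intro x
  rcases p'.eq_zero_or_pos with rfl | hp'
  · refine ⟨univ, univ_mem, 0, fun y _ i _ I v hv => ?_⟩
    rw [Subsingleton.elim v 0, norm_zero] at hv
    exact absurd hv (lt_irrefl 0)
  obtain ⟨U, hU, R, hR⟩ := hb x
  refine ⟨U, hU, max R 0, fun y hy i hi I v hv => Grass.ext_coef fun J => ?_⟩
  have hs := (S.chart i).map_source hi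
  have hB := hf.sqrtCoef_eq_zero (hp hp') hs (fun I v hv => hR y hy i hi I v hv) J
  have hv2 : max R 0 ^ 2 < ∑ c, v c ^ 2 :=
    (pow_lt_pow_left₀ hv (le_max_right _ _) two_ne_zero).trans_le (norm_sq_le_sum_sq v)
  rw [hf'.coef_eq hs, Grass.coef_taylorNormSq_eq_sum]
  simp only [iteratedDerivWithin_Ici_eq_zero hB _ hv2]
  simp [Grass.coef]

/-- Extension by zero `ℝ^p' → ℝ^p`. -/
def extendZero (_ : p' ≤ p) : (Fin p' → ℝ) →L[ℝ] Fin p → ℝ :=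
  ContinuousLinearMap.pi fun c =>
    if hc : (c : ℕ) < p' then ContinuousLinearMap.proj (⟨c, hc⟩ : Fin p') else 0

theorem sum_extendZero_sq (h : p' ≤ p) (v : Fin p' → ℝ) :
    ∑ c, extendZero h v c ^ 2 = ∑ c, v c ^ 2 := by
  obtain ⟨k, rfl⟩ := Nat.exists_eq_add_of_le h
  rw [Fin.sum_univ_add]
  simp [extendZero]

/-- Smoothness of the new coefficients costs nothing: for `l ≤ q` some coefficient of `f` is already
a nonzero multiple of the `l`-th derivative of the profile at `‖v‖²`. It suffices to restrict it to
`ℝ^p'` and rescale. -/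
theorem FibreFun.IsRadial.exists_isRadial {f : S.FibreFun p (2 * q)} {fo : S.Profile}
    (hf : f.IsRadial fo) (hp : p' ≤ p) (hq : q' ≤ q) :
    ∃ f' : S.FibreFun p' (2 * q'), f'.IsRadial fo := by
  have hex : ∀ l, ∃ I, l ≤ q → Grass.coef I (oddNormSq q ^ l) ≠ 0 := fun l => by
    by_cases hl : l ≤ q
    · exact (Grass.exists_coef_oddNormSq_pow_ne_zero hl).imp fun _ h _ => h
    · exact ⟨∅, fun h => absurd h hl⟩
  choose I₀ hI₀ using hex
  -- For odd `I.card` the division rounds down, but then the numerator vanishes by degree, as it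
  -- should.
  refine ⟨fun I => (f (I₀ (I.card / 2))).smulComp (Grass.coef I (oddNormSq q' ^ (I.card / 2)) /
    Grass.coef (I₀ (I.card / 2)) (oddNormSq q ^ (I.card / 2))) (extendZero hp),
    fun i s hs v J => Grass.ext_coef fun I => ?_⟩
  rw [FibreFun.coef_oddCoef]
  simp only [Superfun.smulComp, Grass.coef_smul]
  set l := I.card / 2
  have hIc : I.card ≤ 2 * q' := by simpa using I.card_le_univ
  have hl : l ≤ q' := by omega
  have hne := hI₀ l (hl.trans hq)
  have hcard : (I₀ l).card = 2 * l := by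
    by_contra h
    exact hne (Grass.coef_oddNormSq_pow_eq_zero h)
  rw [hf.coef_eq hs, sum_extendZero_sq, Grass.coef_taylorNormSq (hl.trans hq) _ hcard]
  by_cases hI : I.card = 2 * l
  · rw [Grass.coef_taylorNormSq hl _ hI]
    field_simp
  · have hodd : ∀ k, Grass.coef I (oddNormSq q' ^ k) = 0 := fun k =>
      Grass.coef_oddNormSq_pow_eq_zero (by omega)
    rw [Grass.coef_taylorNormSq_eq_sum]
    simp [hodd]

/-- Radial superfunctions with the same profile and the same `p - 2q` have the same fibre
integral. -/
theorem FibreFun.IsRadial.hasFibreIntegral {f : S.FibreFun p (2 * q)}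
    {f' : S.FibreFun p' (2 * q')} {fo : S.Profile} (hf : f.HasProfile fo) (hf' : f'.IsRadial fo)
    (hb : f.LocallyBounded) (hb' : f'.LocallyBounded) (hpq : p' + 2 * q = p + 2 * q')
    {h : S.BaseFun} (hh : HasFibreIntegral f h) : HasFibreIntegral f' h := by
  refine fun i s hs J => ⟨hb'.fibreIntegrable i hs J, ?_⟩
  rw [(hh i s hs J).2, hf.isRadial.fibreIntegral_eq hs, hf'.fibreIntegral_eq hs]
  have hH := (hf.regular i s hs J).1
  -- Compact support of `f` bounds the profile only if `p > 0`. When `q ≠ q'`, the space of larger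
  -- odd dimension has positive even dimension; it supplies both this bound and the
  -- differentiability for the integrations by parts.
  have hex : 0 < p ∨ 0 < p' → ∃ B, ∀ r, B < r → fo.sqrtCoef i s J r = 0 := fun h =>
    h.elim (fun hp => hb.sqrtCoef_eq_zero hp hf.isRadial hs J)
      fun hp => hb'.sqrtCoef_eq_zero hp hf' hs J
  rcases lt_trichotomy q q' with hq | rfl | hq
  · obtain ⟨k, rfl⟩ := Nat.exists_eq_add_of_lt hq
    obtain rfl : p' = p + 2 * (k + 1) := by omega
    obtain ⟨B, hB⟩ := hex (Or.inr (by omega))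
    exact (radialIntegral_add (k := k + 1) hH (hf'.contDiffOn (by omega) hf.regular hs J) hB).symm
  · obtain rfl : p' = p := by omega
    rfl
  · obtain ⟨k, rfl⟩ := Nat.exists_eq_add_of_lt hq
    obtain rfl : p = p' + 2 * (k + 1) := by omega
    obtain ⟨B, hB⟩ := hex (Or.inl (by omega))
    exact radialIntegral_add (k := k + 1) hH (hf.contDiffOn hs J) hB

end CSManifold

end

section

/-! ### Explicit forms of the radial integral -/

theorem rpow_smul_comp_sqrt (g : ℝ → ℂ) (a : ℝ) {y : ℝ} (hy : 0 < y) :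
    y ^ ((2 : ℝ) - 1) • ((y ^ (2 : ℝ)) ^ (a / 2 - 1) • g (√(y ^ (2 : ℝ)))) =
      y ^ (a - 1) • g y := by
  rw [smul_smul, ← Real.rpow_mul hy.le, ← Real.rpow_add hy, Real.rpow_two, Real.sqrt_sq hy.le]
  congr 2
  ring

theorem integrableOn_rpow_smul_comp_sqrt (g : ℝ → ℂ) (a : ℝ) :
    IntegrableOn (fun r : ℝ => r ^ (a / 2 - 1) • g (√r)) (Ioi 0) ↔
      IntegrableOn (fun r : ℝ => r ^ (a - 1) • g r) (Ioi 0) := by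
  rw [← integrableOn_Ioi_comp_rpow_iff' _ two_ne_zero]
  exact integrableOn_congr_fun (fun y hy => rpow_smul_comp_sqrt g a hy) measurableSet_Ioi

theorem integral_rpow_smul_comp_sqrt (g : ℝ → ℂ) (a : ℝ) :
    ∫ r in Ioi (0 : ℝ), r ^ (a / 2 - 1) • g (√r) =
      (2 : ℝ) • ∫ r in Ioi (0 : ℝ), r ^ (a - 1) • g r := by
  rw [← integral_comp_rpow_Ioi_of_pos (g := fun r : ℝ => r ^ (a / 2 - 1) • g (√r)) two_pos]
  simp only [mul_smul]
  rw [integral_smul]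
  congr 1
  exact setIntegral_congr_fun measurableSet_Ioi fun y hy => rpow_smul_comp_sqrt g a hy

theorem radialIntegral_of_pos {p : ℕ} (hp : 0 < p) (q : ℕ) {H : ℝ → ℂ}
    (hH : ContDiffOn ℝ ∞ H (Ioi 0)) :
    radialIntegral p q H =
      (Real.pi ^ (((p : ℝ) - 2 * q) / 2) * (-1) ^ q / Real.Gamma ((p : ℝ) / 2)) •
        ∫ r in Ioi (0 : ℝ), r ^ ((p : ℝ) / 2 - 1) • iteratedDeriv q H r := by
  rw [radialIntegral, if_neg hp.ne', smul_smul]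
  congr 1
  · rw [show ((p : ℝ) - 2 * q) / 2 = (p : ℝ) / 2 - q by ring, Real.rpow_sub_natCast Real.pi_pos.ne',
      zpow_neg, zpow_natCast, neg_pow, mul_inv, ← inv_pow, inv_neg_one]
    ring
  · exact setIntegral_congr_fun measurableSet_Ioi fun r hr => by
      simp only [iteratedDerivWithin_Ici_eq hH q hr]

theorem radialIntegral_one {H : ℝ → ℂ} (hH : ContDiffOn ℝ ∞ H (Ioi 0)) (n : ℕ) :
    radialIntegral 1 n H = (-Real.pi) ^ (-(n : ℤ)) •
      ∫ r in Ioi (0 : ℝ), r ^ (-(1 / 2) : ℝ) • iteratedDeriv n H r := by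
  have hpi : Real.pi ^ (1 / 2 : ℝ) ≠ 0 := (Real.rpow_pos_of_pos Real.pi_pos _).ne'
  rw [radialIntegral, if_neg one_ne_zero, Nat.cast_one, Real.Gamma_one_half_eq, Real.sqrt_eq_rpow,
    div_self hpi, one_smul]
  congr 1
  refine setIntegral_congr_fun measurableSet_Ioi fun r hr => ?_
  simp only [iteratedDerivWithin_Ici_eq hH n hr]
  norm_num

namespace CSManifold

variable {S : CSManifold.{u, v}} {p q : ℕ}

/-- Two-sided smoothness at 0 comes from the domain `(-ε, ∞)` if `p > 0`, and from the dependence on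
`t²` if `p = 0`. -/
theorem FibreFun.HasProfile.contDiffAt_zero {f : S.FibreFun p (2 * q)} {fo : S.Profile}
    (hf : f.HasProfile fo) {i : S.Idx} {s : Fin (S.m i) → ℝ} (hs : s ∈ (S.chart i).target)
    (J : Finset (Fin (S.n i))) : ContDiffAt ℝ ∞ (fun t => Grass.coef J (fo i s t)) 0 := by
  rcases hf with ⟨_, ε, hε, F, rfl, _⟩ | ⟨_, G, _, hG⟩
  · exact (F.contDiffOn_right i J hs).contDiffAt (Ioi_mem_nhds (neg_neg_of_pos hε))
  · simp only [hG i s hs]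
    exact ((G.contDiff_right i J hs).comp (contDiff_id.pow 2)).contDiffAt

end CSManifold

end

/-! ### The theorem -/

theorem mainTheorem8 (S : CSManifold.{u, v}) (p q : ℕ) (f : S.FibreFun p (2 * q))
    (fo : ∀ i, (Fin (S.m i) → ℝ) → ℝ → Grass (S.n i))
    (hf : CSManifold.FibreFun.HasProfile f fo) :
    -- arbitrary support: existence and value of the fibre integral
    (0 < p → ∀ i, ∀ s ∈ (S.chart i).target, ∀ J,
      (CSManifold.FibreIntegrable f i s J ↔
        IntegrableOn (fun r : ℝ => r ^ ((p : ℝ) / 2 - 1) •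
          iteratedDeriv q (fun t : ℝ => Grass.coef J (fo i s (√t))) r) (Ioi 0)) ∧
      (CSManifold.FibreIntegrable f i s J →
        CSManifold.fibreIntegral f i s J =
          (Real.pi ^ (((p : ℝ) - 2 * q) / 2) * (-1) ^ q / Real.Gamma ((p : ℝ) / 2)) •
            ∫ r in Ioi (0 : ℝ), r ^ ((p : ℝ) / 2 - 1) •
              iteratedDeriv q (fun t : ℝ => Grass.coef J (fo i s (√t))) r)) ∧
    (p = 0 → ∀ i, ∀ s ∈ (S.chart i).target, ∀ J,
      CSManifold.FibreIntegrable f i s J ∧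
      CSManifold.fibreIntegral f i s J =
        (-Real.pi) ^ (-(q : ℤ)) •
          iteratedDerivWithin q (fun t : ℝ => Grass.coef J (fo i s (√t))) (Ici 0) 0) ∧
    -- support compact in the fibres
    (CSManifold.FibreFun.FibreCompact f →
      ∃ h : S.BaseFun, CSManifold.HasFibreIntegral f h ∧
        -- reduction from `p|2q` to `p-2k|2q-2k`
        (∀ k : ℕ, 2 * k ≤ p → k ≤ q →
          (∃ f' : S.FibreFun (p - 2 * k) (2 * (q - k)), CSManifold.FibreFun.IsRadial f' fo) ∧
          ∀ f' : S.FibreFun (p - 2 * k) (2 * (q - k)), CSManifold.FibreFun.IsRadial f' fo →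
            CSManifold.FibreFun.FibreCompact f' ∧ CSManifold.HasFibreIntegral f' h) ∧
        -- the integral depends only on `p - 2q` and the radial profile
        (∀ p' q' : ℕ, p' + 2 * q = p + 2 * q' → ∀ f' : S.FibreFun p' (2 * q'),
          CSManifold.FibreFun.IsRadial f' fo → CSManifold.FibreFun.FibreCompact f' →
            CSManifold.HasFibreIntegral f' h) ∧
        -- `p - 2q > 0`
        (2 * q < p → ∀ i, ∀ s ∈ (S.chart i).target, ∀ J,
          IntegrableOn (fun r : ℝ => r ^ ((p : ℝ) - 2 * q - 1) • Grass.coef J (fo i s r))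
            (Ioi 0) ∧
          Grass.coef J (h.toFun i s 0) =
            (2 * Real.pi ^ (((p : ℝ) - 2 * q) / 2) / Real.Gamma (((p : ℝ) - 2 * q) / 2)) •
              ∫ r in Ioi (0 : ℝ), r ^ ((p : ℝ) - 2 * q - 1) • Grass.coef J (fo i s r)) ∧
        -- `p - 2q = -2n ≤ 0` even
        (∀ n : ℕ, 2 * q = p + 2 * n → ∀ i, ∀ s ∈ (S.chart i).target, ∀ J,
          Grass.coef J (h.toFun i s 0) =
            (-Real.pi) ^ (-(n : ℤ)) •
              iteratedDerivWithin n (fun t : ℝ => Grass.coef J (fo i s (√t))) (Ici 0) 0 ∧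
          Grass.coef J (h.toFun i s 0) =
            ((-Real.pi) ^ (-(n : ℤ)) * ((n.factorial : ℝ) / ((2 * n).factorial : ℝ))) •
              iteratedDeriv (2 * n) (fun t : ℝ => Grass.coef J (fo i s t)) 0) ∧
        -- `p - 2q = 1 - 2n < 0` odd
        (∀ n : ℕ, 0 < n → 2 * q + 1 = p + 2 * n → ∀ i, ∀ s ∈ (S.chart i).target, ∀ J,
          IntegrableOn (fun r : ℝ => r ^ (-(1 / 2) : ℝ) •
            iteratedDeriv n (fun t : ℝ => Grass.coef J (fo i s (√t))) r) (Ioi 0) ∧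
          Grass.coef J (h.toFun i s 0) =
            (-Real.pi) ^ (-(n : ℤ)) •
              ∫ r in Ioi (0 : ℝ), r ^ (-(1 / 2) : ℝ) •
                iteratedDeriv n (fun t : ℝ => Grass.coef J (fo i s (√t))) r)) := by
  have hrad : CSManifold.FibreFun.IsRadial f fo := CSManifold.FibreFun.HasProfile.isRadial hf
  have hreg : CSManifold.Profile.Regular fo := CSManifold.FibreFun.HasProfile.regular hf
  refine ⟨fun hp i s hs J => ⟨?_, fun _ => ?_⟩, fun hp i s hs J => ⟨?_, ?_⟩, fun hc => ?_⟩
  · rw [hrad.fibreIntegrable_iff hp hs J]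
    exact integrableOn_congr_fun (fun r hr => by
      simp only [iteratedDerivWithin_Ici_eq (hreg i s hs J).1 q hr]) measurableSet_Ioi
  · rw [hrad.fibreIntegral_eq hs]
    exact radialIntegral_of_pos hp q (hreg i s hs J).1
  · exact CSManifold.fibreIntegrable_of_eq_zero hp f i s J
  · rw [hrad.fibreIntegral_eq hs, radialIntegral, if_pos hp]
  have hb : CSManifold.FibreFun.LocallyBounded f :=
    CSManifold.FibreFun.FibreCompact.locallyBounded hc
  have hh := hb.hasFibreIntegral
  have hB : ∀ i, ∀ s ∈ (S.chart i).target, ∀ J, 0 < p →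
      ∃ B, ∀ r, B < r → CSManifold.Profile.sqrtCoef fo i s J r = 0 :=
    fun i s hs J hp => hb.sqrtCoef_eq_zero hp hrad hs J
  have hval : ∀ i, ∀ s ∈ (S.chart i).target, ∀ J, Grass.coef J (hb.integral.toFun i s 0) =
      radialIntegral p q (CSManifold.Profile.sqrtCoef fo i s J) := fun i s hs J => by
    rw [(hh i s hs J).2, hrad.fibreIntegral_eq hs]
  -- The reduction at the level of profiles, with no superfunction on the smaller space needed. If
  -- `k > 0` then `p > 0`, so the profile vanishes for large `r`.
  have hred : ∀ p₀ q₀ k, p₀ + 2 * k = p → q₀ + k = q → ∀ i, ∀ s ∈ (S.chart i).target, ∀ J,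
      Grass.coef J (hb.integral.toFun i s 0) =
        radialIntegral p₀ q₀ (CSManifold.Profile.sqrtCoef fo i s J) := by
    rintro p₀ q₀ k rfl rfl i s hs J
    rw [hval i s hs J]
    rcases k.eq_zero_or_pos with rfl | hk
    · rfl
    · obtain ⟨B, hB⟩ := hB i s hs J (by omega)
      exact radialIntegral_add (hreg i s hs J).1
        (CSManifold.FibreFun.HasProfile.contDiffOn hf hs J) hB
  refine ⟨hb.integral, hh, fun k hkp hkq => ⟨hrad.exists_isRadial (by omega) (by omega),
    fun f' hf' => ?_⟩, fun p' q' hpq f' hf' hc' => ?_, fun hpq i s hs J => ?_,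
    fun n hn i s hs J => ?_, fun n hn0 hn i s hs J => ?_⟩
  · have hb' := hrad.locallyBounded hf' (by omega) hb
    exact ⟨hb'.fibreCompact, hf'.hasFibreIntegral hf hb hb' (by omega) hh⟩
  · exact hf'.hasFibreIntegral hf hb
      (CSManifold.FibreFun.FibreCompact.locallyBounded hc') hpq hh
  · obtain ⟨B, hB⟩ := hB i s hs J (by omega)
    have ha : ((p - 2 * q : ℕ) : ℝ) = (p : ℝ) - 2 * q := by
      rw [Nat.cast_sub hpq.le]
      push_cast
      rfl
    have ha0 : 0 < (p : ℝ) - 2 * q := by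
      rw [← ha]
      exact_mod_cast (by omega : 0 < p - 2 * q)
    refine ⟨?_, ?_⟩
    · refine (integrableOn_rpow_smul_comp_sqrt (fun t => Grass.coef J (fo i s t)) _).1
        (integrableOn_rpow_smul (by linarith)
          (CSManifold.FibreFun.HasProfile.contDiffOn hf hs J).continuousOn hB)
    -- All odd directions are removed; the substitution of `r²` for `r` contributes the factor 2.
    · rw [hred (p - 2 * q) 0 q (by omega) (by omega) i s hs J, radialIntegral,
        if_neg (by omega), ha]
      simp only [iteratedDerivWithin_zero, CSManifold.Profile.sqrtCoef]
      rw [integral_rpow_smul_comp_sqrt (fun t => Grass.coef J (fo i s t))]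
      simp only [Nat.cast_zero, neg_zero, zpow_zero, smul_smul]
      congr 1
      ring
  -- All even directions are removed, leaving evaluation at 0 on `𝔸^{0|2n}`.
  · have h1 := hred 0 n (q - n) (by omega) (by omega) i s hs J
    rw [radialIntegral, if_pos rfl] at h1
    refine ⟨h1, ?_⟩
    rw [mul_smul, ← iteratedDerivWithin_eq_iteratedDeriv_two_mul
      (H := CSManifold.Profile.sqrtCoef fo i s J)
      (CSManifold.FibreFun.HasProfile.contDiffAt_zero hf hs J)
      ((CSManifold.FibreFun.HasProfile.contDiffOn hf hs J).of_le (by norm_cast; omega))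
      fun t ht => by simp only [CSManifold.Profile.sqrtCoef, Real.sqrt_sq ht]]
    exact h1
  · obtain ⟨B, hB⟩ := hB i s hs J (by omega)
    have hH := (hreg i s hs J).1
    refine ⟨?_, ?_⟩
    · refine (integrableOn_congr_fun (fun r hr => ?_) measurableSet_Ioi).1
        (integrableOn_rpow_smul (a := -(1 / 2)) (by norm_num)
          ((CSManifold.FibreFun.HasProfile.contDiffOn hf hs J).continuousOn_iteratedDerivWithin
            (m := n) (by norm_cast; omega) (uniqueDiffOn_Ici 0))
          fun r hr => iteratedDerivWithin_Ici_eq_zero hB n hr)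
      simp only [iteratedDerivWithin_Ici_eq hH n hr]
    -- One even direction is left, where the constant `π^{1/2} / Γ(1/2)` equals 1.
    · rw [hred 1 n (q - n) (by omega) (by omega) i s hs J]
      exact radialIntegral_one hH n
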